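/- Let $A$ be a finite non-empty digraph, that is, a finite non-empty set with a binary relation $\to$. Assume that $A$ is smooth (every vertex has at least one outgoing and at least one incoming edge), loopless (there is no $a$ with $a\to a$), and linked (the transitive closure of the relation $\{(x,y) : \exists z\; x\to z \wedge y\to z\}$ is $A^2$). Let $G$ be any subgroup of the automorphism group $\operatorname{Aut}(A)$. Let $\mathfrak{A}$ be the expansion of $(A;\to)$ by all orbits of $G$, i.e. the relational structure on $A$ whose relations are $\to$ and, for every $n\ge 1$, every orbit of the coordinatewise action of $G$ on $A^n$. Then $\mathfrak{A}$ pp-interprets the three-element clique $K_3$, and hence $\mathfrak{A}$ pp-interprets every relational structure with a finite domain. Here a relation is pp-definable in a structure if it is defined by a first-order formula without parameters that is built from atomic formulas (including equalities) using only conjunction and existential quantification. A structure $\mathfrak{A}$ with domain $A$ pp-interprets a relational structure $\mathfrak{B}$ with domain $B$ if there are $d\ge 1$ and a surjective partial map $h\colon A^d\to B$ such that for each $R\subseteq B^n$ that is $B$ itself, the equality relation on $B$, or a relation of $\mathfrak{B}$, the preimage $h^{-1}(R)$, seen as an $nd$-ary relation on $A$, is pp-definable in $\mathfrak{A}$. 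-/

import Mathlib

universe u v w x

/-! ### Digraphs -/

namespace Digraph

variable {A : Type u} (D : Digraph A)

/-- A digraph is smooth if its edge relation is subdirect: there are no sources and no sinks. -/
def IsSmooth : Prop :=
  (∀ a, ∃ b, D.Adj a b) ∧ (∀ a, ∃ b, D.Adj b a)

/-- The link relation: `x` and `y` have a common out-neighbour. -/
def Link (x y : A) : Prop :=
  ∃ z, D.Adj x z ∧ D.Adj y z

/-- A digraph is linked if the transitive closure of its link relation is the full relation. -/
def IsLinked : Prop :=
  ∀ x y, Relation.TransGen D.Link x y

/-- A digraph is loopless if no vertex is adjacent to itself. -/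
def IsLoopless : Prop :=
  ∀ a, ¬ D.Adj a a

/-- The automorphism group of a digraph. -/
abbrev Aut : Type u := D.Adj ≃r D.Adj

end Digraph

/-! ### Primitive positive definability and interpretability -/

namespace PrimitivePositive

/-- Primitive positive formulas: those built from atomic formulas (relation symbols and equality)
by conjunction and existential quantification. -/
inductive IsPP {L : FirstOrder.Language} {α : Type*} : ∀ {n : ℕ}, L.BoundedFormula α n → Prop
  | atomic {n : ℕ} {φ : L.BoundedFormula α n} : φ.IsAtomic → IsPP φ
  | inf {n : ℕ} {φ ψ : L.BoundedFormula α n} : IsPP φ → IsPP ψ → IsPP (φ ⊓ ψ)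
  | ex {n : ℕ} {φ : L.BoundedFormula α (n + 1)} : IsPP φ → IsPP φ.ex

/-- A relation on `M`, with coordinates indexed by `α`, is pp-definable in the `L`-structure `M`
(without parameters). -/
def PPDefinable (L : FirstOrder.Language) {M : Type*} [L.Structure M] {α : Type*}
    (S : Set (α → M)) : Prop :=
  ∃ φ : L.Formula α, IsPP φ ∧ ∀ v : α → M, v ∈ S ↔ φ.Realize v

/-- The preimage of an `n`-ary relation on `N` under a partial map from `M ^ d` to `N`,
as a relation of arity `n * d` on `M`; the coordinate `(i, j)` is the `j`-th entry of
the `i`-th `d`-tuple. -/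
def preimageRel {M N : Type*} {d : ℕ} (h : (Fin d → M) →. N) {n : ℕ}
    (R : (Fin n → N) → Prop) : Set (Fin n × Fin d → M) :=
  {x | ∃ y : Fin n → N, (∀ i, y i ∈ h (fun j => x (i, j))) ∧ R y}

/-- The structure `M` pp-interprets the relational structure `N`: there are `d ≥ 1` and a
surjective partial map from `M ^ d` to `N` such that the preimages of `N`, of the equality
on `N` and of every relation of `N` are pp-definable in `M`. -/
def PPInterprets (L : FirstOrder.Language) (M : Type*) [L.Structure M]
    (L' : FirstOrder.Language) [L'.IsRelational] (N : Type*) [L'.Structure N] : Prop :=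
  ∃ d : ℕ, 1 ≤ d ∧ ∃ h : (Fin d → M) →. N,
    (∀ b : N, ∃ a : Fin d → M, b ∈ h a) ∧
    PPDefinable L (preimageRel h (fun _ : Fin 1 → N => True)) ∧
    PPDefinable L (preimageRel h (fun y : Fin 2 → N => y 0 = y 1)) ∧
    ∀ (n : ℕ) (R : L'.Relations n),
      PPDefinable L (preimageRel h (fun y : Fin n → N => FirstOrder.Language.Structure.RelMap R y))

/-! ### The expansion of a digraph by the orbits of a group of automorphisms -/

/-- The relation symbols: one binary symbol for the edge relation and, for every arity
`n + 1 ≥ 1`, one symbol for each orbit of `G` acting coordinatewise on `(n + 1)`-tuples. -/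
inductive OrbitSymbol {A : Type u} (D : Digraph A) (G : Subgroup D.Aut) : ℕ → Type u
  | adj : OrbitSymbol D G 2
  | orbit {n : ℕ} (O : MulAction.orbitRel.Quotient G (Fin (n + 1) → A)) : OrbitSymbol D G (n + 1)

/-- The relational language of the expansion of `D` by the orbits of `G`. -/
def orbitLanguage {A : Type u} (D : Digraph A) (G : Subgroup D.Aut) : FirstOrder.Language.{0, u} where
  Functions := fun _ => Empty
  Relations := OrbitSymbol D G

/-- The digraph `D` expanded by the orbits of `G`. -/
instance orbitStructure {A : Type u} (D : Digraph A) (G : Subgroup D.Aut) :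
    (orbitLanguage D G).Structure A where
  funMap := fun f => Empty.elim f
  RelMap
    | .adj => fun x => D.Adj (x 0) (x 1)
    | .orbit O => fun x => x ∈ O.orbit

/-- The vertex set of the three-element clique. -/
def K3 : Type := Fin 3

/-- The three-element clique as a structure with one binary relation. -/
instance : FirstOrder.Language.graph.Structure K3 :=
  (⊤ : SimpleGraph (Fin 3)).structure

end PrimitivePositive

/-! On a finite structure the relations invariant under all polymorphisms are pp-definable. So it
suffices that the polymorphisms act as projections on a set of tuples split into two nonempty
classes: elements of any finite structure can then be coded by blocks from these classes, and all
preimages are invariant. This reduces the theorem to `isDictatorial_of_digraph`, a statement about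
clones. The orbits of `G` enter only through `isCore_polymorphisms`: unary polymorphisms are
injective, so every operation becomes idempotent after composition with a unary one.

The sets with a common out-neighbour form an invariant simplicial complex. Take a maximal proper
invariant complex containing the vertices and links, and let `n` be the size of a smallest non-face.
If all faces can be coned off by one vertex, there is a proper symmetric invariant relation with a
nonempty center, and `isDictatorial_or_exists_absorbs` gives projections or a proper absorbing
subuniverse. Otherwise the complex is closed under coning. Linkedness then excludes `n = 2`, and for
`n ≥ 3` the `n`-tuples listing faces form an exchange relation. Failure to lie in such a relation
can be traced to single columns, and an operation sensitive in as many positions as possible forces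
every operation to select one column (`IsExchangeRelation.isDictatorial`).

A proper absorbing subuniverse leads to a smaller one, on which the digraph or its reverse is again
smooth, linked and loopless; induction on the number of vertices finishes the proof. -/

/-- A concrete clone on `A`: a set of operations, of arbitrary arities, that contains the
projections and is closed under composition. -/
structure OpClone (A : Type u) where
  mem : ∀ {ι : Type}, ((ι → A) → A) → Prop
  proj : ∀ {ι : Type} (i : ι), mem (fun x => x i)
  comp : ∀ {ι κ : Type} {f : (ι → A) → A} {g : ι → (κ → A) → A},
    mem f → (∀ i, mem (g i)) → mem (fun x => f (fun i => g i x))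

namespace OpClone

variable {A : Type u} (C : OpClone A)

/-- The unary operations of a clone. -/
def Unary (g : A → A) : Prop := C.mem (fun x : Unit → A => g (x ()))

/-- A clone is a core clone if its unary operations are injective. -/
def IsCore : Prop := ∀ g, C.Unary g → Function.Injective g

/-- An operation applied to a family of columns, row by row. -/
def rowwise {ι N : Type*} (f : (ι → A) → A) (X : ι → N → A) : N → A :=
  fun r => f (fun i => X i r)

/-- Invariance of a relation under a clone. -/
def Preserves {N : Type*} (R : Set (N → A)) : Prop :=
  ∀ ⦃ι : Type⦄ [Finite ι] ⦃f : (ι → A) → A⦄, C.mem f →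
    ∀ X : ι → N → A, (∀ i, X i ∈ R) → rowwise f X ∈ R

/-- Every operation acts on `U`, modulo the partition into `S` and `U \ S`, as a projection. -/
def IsDictatorial : Prop :=
  ∃ (d : ℕ) (U S : Set (Fin d → A)), S ⊆ U ∧ S.Nonempty ∧ (U \ S).Nonempty ∧
    ∀ (ι : Type) [Finite ι] (f : (ι → A) → A), C.mem f →
      ∃ j : ι, ∀ X : ι → Fin d → A, (∀ i, X i ∈ U) →
        rowwise f X ∈ U ∧ (rowwise f X ∈ S ↔ X j ∈ S)

variable {C}

theorem unary_diag {ι : Type} {f : (ι → A) → A} (hf : C.mem f) :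
    C.Unary (fun a => f (fun _ => a)) :=
  C.comp hf (fun _ => C.proj ())

theorem unary_id : C.Unary (fun a => a) := C.proj ()

theorem Unary.mem_comp {ι : Type} {f : (ι → A) → A} {g : A → A} (hg : C.Unary g)
    (hf : C.mem f) : C.mem (fun x => g (f x)) :=
  C.comp (f := fun x : Unit → A => g (x ())) hg (fun _ => hf)

theorem Unary.comp {g h : A → A} (hg : C.Unary g) (hh : C.Unary h) :
    C.Unary (fun a => g (h a)) :=
  hg.mem_comp hh

theorem mem_comp_unary {ι : Type} {f : (ι → A) → A} {g : ι → A → A} (hf : C.mem f)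
    (hg : ∀ i, C.Unary (g i)) : C.mem (fun x => f (fun i => g i (x i))) :=
  C.comp hf (fun i => (hg i).mem_comp (C.proj i))

theorem mem_reindex {ι κ : Type} {f : (ι → A) → A} (hf : C.mem f) (σ : ι → κ) :
    C.mem (fun x : κ → A => f (fun i => x (σ i))) :=
  C.comp hf (fun i => C.proj (σ i))

theorem unary_iterate {g : A → A} (hg : C.Unary g) (n : ℕ) : C.Unary (g^[n]) := by
  induction n with
  | zero => exact unary_id
  | succ n ih => simpa [Function.iterate_succ, Function.comp_def] using ih.comp hg

/-- A permutation of a finite set has finite order, so its inverse is one of its iterates and stays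
in the clone. -/
theorem Unary.exists_inverse [Finite A] (hC : C.IsCore) {g : A → A} (hg : C.Unary g) :
    ∃ g', C.Unary g' ∧ (∀ a, g' (g a) = a) ∧ ∀ a, g (g' a) = a := by
  have hb : Function.Bijective g := Finite.injective_iff_bijective.1 (hC g hg)
  let e : Equiv.Perm A := Equiv.ofBijective g hb
  obtain ⟨k, hk, hk1⟩ := isOfFinOrder_iff_pow_eq_one.1 (isOfFinOrder_of_finite e)
  have he : ∀ a, g^[k] a = a := by
    intro a
    have : (e ^ k) a = a := by rw [hk1]; rfl
    rwa [← Equiv.Perm.iterate_eq_pow] at this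
  obtain ⟨k, rfl⟩ : ∃ m, k = m + 1 := ⟨k - 1, by omega⟩
  refine ⟨g^[k], unary_iterate hg k, fun a => ?_, fun a => ?_⟩
  · rw [← Function.iterate_succ_apply]; exact he a
  · rw [← Function.iterate_succ_apply' g k a]; exact he a

/-- Every operation of a core clone is idempotent up to a unary operation. -/
theorem exists_idempotent [Finite A] (hC : C.IsCore) {ι : Type} {f : (ι → A) → A}
    (hf : C.mem f) :
    ∃ g g', C.Unary g ∧ C.Unary g' ∧ (∀ a, g' (g a) = a) ∧ (∀ a, g (g' a) = a) ∧
      (∀ a, f (fun _ => a) = g a) ∧ C.mem (fun x => g' (f x)) := by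
  obtain ⟨g', h1, h2, h3⟩ := (unary_diag hf).exists_inverse hC
  exact ⟨_, g', unary_diag hf, h1, h2, h3, fun _ => rfl, h1.mem_comp hf⟩

end OpClone

/-! ### Exchange relations and active columns -/

namespace OpClone

variable {A : Type u} {C : OpClone A} {n : ℕ} {R : Set (Fin n → A)} {ι : Type} [Finite ι]
  {f : (ι → A) → A}

/-- An invariant relation of arity at least three that contains all non-injective tuples and
contains `x` as soon as some `u` can be exchanged into every position of `x`. -/
structure IsExchangeRelation (C : OpClone A) (R : Set (Fin n → A)) : Prop where
  arity : 3 ≤ n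
  preserves : C.Preserves R
  of_not_injective : ∀ x, ¬ Function.Injective x → x ∈ R
  exchange : ∀ x, (∃ u, ∀ r, Function.update x r u ∈ R) → x ∈ R

theorem not_injective_of_two_valued (hn : 3 ≤ n) {x : Fin n → A} {p q : A}
    (h : ∀ r, x r = p ∨ x r = q) : ¬ Function.Injective x := by
  intro hx
  have h0 := h ⟨0, by omega⟩
  have h1 := h ⟨1, by omega⟩
  have h2 := h ⟨2, by omega⟩
  have h01 : x ⟨0, by omega⟩ ≠ x ⟨1, by omega⟩ := fun e => by simpa using hx e
  have h02 : x ⟨0, by omega⟩ ≠ x ⟨2, by omega⟩ := fun e => by simpa using hx e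
  have h12 : x ⟨1, by omega⟩ ≠ x ⟨2, by omega⟩ := fun e => by simpa using hx e
  grind

open scoped Classical in
/-- The column `c` in position `j`, with arbitrary constant columns elsewhere, is always mapped
outside of `R`. -/
def Active (R : Set (Fin n → A)) (f : (ι → A) → A) (j : ι) (c : Fin n → A) : Prop :=
  ∀ p : ι → A, rowwise f (fun i => if i = j then c else fun _ => p i) ∉ R

/-- The positions that admit an active column. -/
def activePositions (R : Set (Fin n → A)) (f : (ι → A) → A) : Set ι :=
  {j | ∃ c, Active R f j c}

namespace IsExchangeRelation

theorem two_valued_mem (hR : C.IsExchangeRelation R) {x : Fin n → A} (p q : A)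
    (h : ∀ r, x r = p ∨ x r = q) : x ∈ R :=
  hR.of_not_injective _ (not_injective_of_two_valued hR.arity h)

theorem const_mem (hR : C.IsExchangeRelation R) (p : A) : (fun _ => p) ∈ R :=
  hR.two_valued_mem p p (fun _ => Or.inl rfl)

/-- Overwriting one row with the entry of another creates a repetition; this is the standard way to
force a column into `R`. -/
theorem update_mem_of_ne (hR : C.IsExchangeRelation R) (c : Fin n → A) {r s : Fin n}
    (hrs : r ≠ s) {a : A} (ha : c s = a) : Function.update c r a ∈ R := by
  apply hR.of_not_injective
  intro h
  apply hrs
  apply h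
  simp [Function.update_of_ne hrs.symm, ha]

theorem unary_mem_iff [Finite A] (hC : C.IsCore) (hR : C.IsExchangeRelation R) {g : A → A}
    (hg : C.Unary g) (z : Fin n → A) : (fun r => g (z r)) ∈ R ↔ z ∈ R := by
  obtain ⟨g', hg', h1, -⟩ := hg.exists_inverse hC
  constructor
  · intro h
    have h2 : (fun r => g' (g (z r))) ∈ R :=
      hR.preserves hg' (fun _ => fun r => g (z r)) (fun _ => h)
    simpa only [h1] using h2
  · intro h
    exact hR.preserves hg (fun _ => z) (fun _ => h)

-- Contrapositive of the exchange axiom with `u = f v`. The row in which `v` lands cannot be chosen;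
-- later arguments pick `v` so that every unwanted row is impossible.
omit [Finite ι] in
theorem exists_row (hR : C.IsExchangeRelation R) {X : ι → Fin n → A}
    (hX : rowwise f X ∉ R) (v : ι → A) :
    ∃ r, rowwise f (fun i => Function.update (X i) r (v i)) ∉ R := by
  by_contra! h
  apply hX
  apply hR.exchange
  refine ⟨f v, fun r => ?_⟩
  convert h r using 1
  ext s
  by_cases hs : s = r
  · subst hs; simp [rowwise]
  · simp [rowwise, hs]

theorem exists_bad (hR : C.IsExchangeRelation R) (hf : C.mem f) {X : ι → Fin n → A}
    (hX : rowwise f X ∉ R) : ∃ j, X j ∉ R := by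
  by_contra! h
  exact hX (hR.preserves hf X h)

/-- The offered row has entry `r1` of the columns in `s` and entry `r0` of the others. Written into
`r0` it creates repetitions in the columns of `s`, so only `a` can stay bad; written into `r1` it
repairs all columns outside `s`, and induction applies; anywhere else it repairs every column, which
is impossible. -/
theorem exists_single_bad (hR : C.IsExchangeRelation R) (hf : C.mem f) (J : Finset ι)
    (X : ι → Fin n → A) (hJ : ∀ i, X i ∉ R → i ∈ J) (hX : rowwise f X ∉ R) :
    ∃ j X', X' j = X j ∧ X j ∉ R ∧ (∀ i, i ≠ j → X' i ∈ R) ∧ rowwise f X' ∉ R := by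
  classical
  induction J using Finset.induction_on generalizing X with
  | empty =>
    obtain ⟨j, hj⟩ := hR.exists_bad hf hX
    exact absurd (hJ j hj) (by simp)
  | insert a s ha ih =>
    by_cases hXa : X a ∈ R
    · refine ih X (fun i hi => ?_) hX
      rcases Finset.mem_insert.1 (hJ i hi) with rfl | h
      · exact absurd hXa hi
      · exact h
    have hn := hR.arity
    let r0 : Fin n := ⟨0, by omega⟩
    let r1 : Fin n := ⟨1, by omega⟩
    have h01 : r0 ≠ r1 := by simp [r0, r1]
    obtain ⟨r, hr⟩ := hR.exists_row hX (fun i => if i ∈ s then X i r1 else X i r0)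
    by_cases hr0 : r = r0
    · subst hr0
      refine ⟨a, _, ?_, hXa, fun i hi => ?_, hr⟩
      · simp [ha]
      · by_cases his : i ∈ s
        · simp only [his, if_true]
          exact hR.update_mem_of_ne _ h01 rfl
        · simp only [his, if_false, Function.update_eq_self]
          by_contra h
          rcases Finset.mem_insert.1 (hJ i h) with h | h
          exacts [hi h, his h]
    by_cases hr1 : r = r1
    · subst hr1
      have hbad : ∀ i, Function.update (X i) r1 (if i ∈ s then X i r1 else X i r0) ∉ R → i ∈ s := by
        intro i hi
        by_contra his
        simp only [his, if_false] at hi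
        exact hi (hR.update_mem_of_ne _ h01.symm rfl)
      obtain ⟨j, X', h1, h2, h3, h4⟩ := ih _ hbad hr
      have hj := hbad j h2
      simp only [hj, if_true, Function.update_eq_self] at h1 h2
      exact ⟨j, X', h1, h2, h3, h4⟩
    · obtain ⟨j, hj⟩ := hR.exists_bad hf hr
      refine absurd ?_ hj
      by_cases his : j ∈ s
      · simp only [his, if_true]; exact hR.update_mem_of_ne _ hr1 rfl
      · simp only [his, if_false]; exact hR.update_mem_of_ne _ hr0 rfl

-- The rows of `Y` are offered one after another. A row landing in the wrong place would put all
-- columns of `P` into `R`, against `hP`, so each row lands in its own place. Columns outside `P`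
-- need no control.
open scoped Classical in
omit [Finite ι] in
theorem rowwise_not_mem_of_mix (hR : C.IsExchangeRelation R) (P : Set ι)
    (hP : ∀ X : ι → Fin n → A, rowwise f X ∉ R → ∃ j ∈ P, X j ∉ R) {X Y : ι → Fin n → A}
    (hXY : ∀ (s : Finset (Fin n)) (r₀ r : Fin n), r ≠ r₀ → ∀ j ∈ P,
      Function.update (fun r => if r ∈ s then Y j r else X j r) r (Y j r₀) ∈ R)
    (hX : rowwise f X ∉ R) : rowwise f Y ∉ R := by
  have key : ∀ s : Finset (Fin n),
      rowwise f (fun j r => if r ∈ s then Y j r else X j r) ∉ R := by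
    intro s
    induction s using Finset.induction_on with
    | empty => simpa using hX
    | insert a s ha ih =>
      obtain ⟨r, hr⟩ := hR.exists_row ih (fun j => Y j a)
      by_cases hra : r = a
      · subst hra
        convert hr using 3
        ext j q
        by_cases hq : q = r
        · subst hq; simp
        · simp [hq]
      · obtain ⟨j, hj, hj'⟩ := hP _ hr
        exact absurd (hXY s a r hra j hj) hj'
  simpa using key Finset.univ

/-- If `f` maps the columns `X` outside of `R`, then one of the columns is active. -/
theorem exists_active (hR : C.IsExchangeRelation R) (hf : C.mem f) {X : ι → Fin n → A}
    (hX : rowwise f X ∉ R) : ∃ j, X j ∉ R ∧ Active R f j (X j) := by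
  classical
  have hn := hR.arity
  let r0 : Fin n := ⟨0, by omega⟩
  have hP : ∀ X : ι → Fin n → A, rowwise f X ∉ R → ∃ j ∈ Set.univ, X j ∉ R := fun X hX => by
    simpa using hR.exists_bad hf hX
  cases nonempty_fintype ι
  obtain ⟨j, X', h1, h2, h3, h4⟩ := hR.exists_single_bad hf Finset.univ X (by simp) hX
  -- The other columns lie in `R` and can first be flattened to their entry in row `r0`.
  have h5 : rowwise f (fun i => if i = j then X j else fun _ => X' i r0) ∉ R := by
    refine hR.rowwise_not_mem_of_mix Set.univ hP (fun s r₁ r hr i _ => ?_) h4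
    by_cases hij : i = j
    · subst hij
      simp only [h1, if_true, ite_self]
      exact hR.update_mem_of_ne _ hr rfl
    · simp only [hij, if_false]
      by_cases hr0 : r = r0
      · subst hr0
        have : Function.update (fun r => if r ∈ s then X' i r0 else X' i r) r0 (X' i r0) =
            (fun r => if r ∈ s then X' i r0 else X' i r) := by
          ext q
          by_cases hq : q = r0
          · subst hq; simp
          · simp [hq]
        rw [this]
        by_cases hs : ∃ q ∈ s, q ≠ r0
        · obtain ⟨q, hq, hq0⟩ := hs
          apply hR.of_not_injective
          intro hinj
          apply hq0
          apply hinj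
          simp [hq]
        · push Not at hs
          convert h3 i hij using 1
          ext q
          split_ifs with hq
          · rw [hs q hq]
          · rfl
      · apply hR.update_mem_of_ne _ hr0
        simp
  refine ⟨j, h2, fun p => ?_⟩
  -- Between two constant columns all intermediate ones take at most two values, so they lie in `R`.
  refine hR.rowwise_not_mem_of_mix Set.univ hP (fun s r₁ r hr i _ => ?_) h5
  by_cases hij : i = j
  · subst hij
    simp only [if_true, ite_self]
    exact hR.update_mem_of_ne _ hr rfl
  · simp only [hij, if_false]
    apply hR.two_valued_mem (p i) (X' i r0)
    intro q
    by_cases hq : q = r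
    · subst hq; simp
    · simp only [Function.update_of_ne hq]
      split_ifs <;> simp

theorem not_mem_of_active [Nonempty A] (hR : C.IsExchangeRelation R) (hf : C.mem f) {j : ι}
    {c : Fin n → A} (h : Active R f j c) : c ∉ R := by
  obtain ⟨a⟩ := ‹Nonempty A›
  intro hc
  refine h (fun _ => a) (hR.preserves hf _ fun i => ?_)
  split_ifs
  · exact hc
  · exact hR.const_mem a

theorem active_of_not_mem (hR : C.IsExchangeRelation R) (hf : C.mem f) {X : ι → Fin n → A}
    (hX : rowwise f X ∉ R) {j : ι} (hj : ∀ i, i ≠ j → X i ∈ R) : Active R f j (X j) := by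
  obtain ⟨i, h1, h2⟩ := hR.exists_active hf hX
  by_cases h : i = j
  · exact h ▸ h2
  · exact absurd (hj i h) h1

theorem active_rowwise_not_mem (hR : C.IsExchangeRelation R) (hf : C.mem f)
    {X : ι → Fin n → A} {j : ι} (h : Active R f j (X j)) (p q : ι → A)
    (hX : ∀ i, i ≠ j → ∀ r, X i r = p i ∨ X i r = q i) : rowwise f X ∉ R := by
  classical
  refine hR.rowwise_not_mem_of_mix Set.univ
    (fun X hX => by simpa using hR.exists_bad hf hX) (fun s r₁ r hr i _ => ?_) (h p)
  by_cases hij : i = j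
  · subst hij
    simp only [if_true, ite_self]
    exact hR.update_mem_of_ne _ hr rfl
  · simp only [hij, if_false]
    apply hR.two_valued_mem (p i) (q i)
    intro t
    by_cases ht : t = r
    · subst ht; simpa using hX i hij r₁
    · simp only [Function.update_of_ne ht]
      split_ifs
      · exact hX i hij t
      · simp

/-- Each active position may independently use one of two entries of an active column. Two different
choices form rows `r0` and `r1` of a matrix whose image is outside `R`, hence injective; so `f`
separates them, and `2 ^ k ≤ |A|` for `k` active positions. -/
theorem ncard_activePositions_le [Finite A] [Nonempty A] (hR : C.IsExchangeRelation R)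
    (hf : C.mem f) : (activePositions R f).ncard ≤ Nat.card A := by
  classical
  have hn := hR.arity
  let r0 : Fin n := ⟨0, by omega⟩
  let r1 : Fin n := ⟨1, by omega⟩
  have h01 : r0 ≠ r1 := by simp [r0, r1]
  obtain ⟨a⟩ := ‹Nonempty A›
  choose! c hc using fun (j : ι) (hj : j ∈ activePositions R f) => hj
  let val : (activePositions R f → Bool) → ι → A := fun x i =>
    if h : i ∈ activePositions R f then (if x ⟨i, h⟩ then c i r1 else c i r0) else a
  have key : ∀ x y : activePositions R f → Bool, ∀ j, x j = false → y j = true →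
      f (val x) ≠ f (val y) := by
    intro x y j hx hy he
    refine hR.active_rowwise_not_mem hf (j := j.1)
      (X := fun i => if i = j.1 then c j.1 else fun r => if r = r1 then val y i else val x i)
      (by simpa using hc j j.2) (val y) (val x) (fun i hi r => ?_) ?_
    · simp only [hi, if_false]
      split_ifs <;> simp
    · apply hR.of_not_injective
      intro hinj
      apply h01
      apply hinj
      simp only [rowwise]
      convert he using 2
      · ext i
        by_cases h : i = j.1
        · subst h; simp [val, hx]
        · simp [h, h01]
      · ext i
        by_cases h : i = j.1
        · subst h; simp [val, hy]
        · simp [h]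
  have hinj : Function.Injective fun x => f (val x) := by
    intro x y hxy
    by_contra hne
    obtain ⟨j, hj⟩ := Function.ne_iff.1 hne
    cases hx : x j <;> cases hy : y j
    · simp [hx, hy] at hj
    · exact key x y j hx hy hxy
    · exact key y x j hy hx hxy.symm
    · simp [hx, hy] at hj
  have h1 := Nat.card_le_card_of_injective _ hinj
  rw [Nat.card_fun, Nat.card_eq_fintype_card (α := Bool), Fintype.card_bool,
    Nat.card_coe_set_eq] at h1
  exact (Nat.lt_two_pow_self).le.trans h1

omit [Finite ι] in
theorem active_unary_comp_iff [Finite A] (hC : C.IsCore) (hR : C.IsExchangeRelation R)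
    {g : A → A} (hg : C.Unary g) (j : ι) (c : Fin n → A) :
    Active R (fun x => g (f x)) j c ↔ Active R f j c :=
  forall_congr' fun _ => not_congr (hR.unary_mem_iff hC hg _)

theorem exists_idempotent_max [Finite A] [Nonempty A] (hC : C.IsCore)
    (hR : C.IsExchangeRelation R) (hne : R ≠ Set.univ) :
    ∃ (ι : Type) (_ : Finite ι) (f : (ι → A) → A), C.mem f ∧ (∀ a, f (fun _ => a) = a) ∧
      (activePositions R f).Nonempty ∧
      ∀ (κ : Type) [Finite κ] (h : (κ → A) → A), C.mem h →
        (activePositions R h).ncard ≤ (activePositions R f).ncard := by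
  let T : Set ℕ := {k | ∃ (ι : Type) (_ : Finite ι) (f : (ι → A) → A),
    C.mem f ∧ (activePositions R f).ncard = k}
  obtain ⟨z, hz⟩ := (Set.ne_univ_iff_exists_notMem R).1 hne
  have hb : BddAbove T := by
    refine ⟨Nat.card A, ?_⟩
    rintro k ⟨ι, _, f, hf, rfl⟩
    exact hR.ncard_activePositions_le hf
  have h0 : C.mem (fun x : Unit → A => x ()) := C.proj ()
  have hT : T.Nonempty := ⟨_, Unit, inferInstance, _, h0, rfl⟩
  obtain ⟨ι, _, f, hf, hk⟩ := Nat.sSup_mem hT hb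
  have hmax : ∀ (κ : Type) [Finite κ] (h : (κ → A) → A), C.mem h →
        (activePositions R h).ncard ≤ (activePositions R f).ncard := by
    intro κ _ h hh
    rw [hk]
    exact le_csSup hb ⟨κ, inferInstance, h, hh, rfl⟩
  obtain ⟨g, g', hg, hg', h1, h2, h3, h4⟩ := exists_idempotent hC hf
  have he : activePositions R (fun x => g' (f x)) = activePositions R f := by
    ext j
    exact exists_congr fun c => hR.active_unary_comp_iff hC hg' j c
  refine ⟨ι, inferInstance, _, h4, fun a => ?_, ?_, ?_⟩
  · rw [h3, h1]
  · rw [he]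
    apply Set.nonempty_of_ncard_ne_zero
    have := hmax Unit _ h0
    have h5 : (activePositions R (fun x : Unit → A => x ())).Nonempty := by
      obtain ⟨j, -, hj⟩ := hR.exists_active h0 (X := fun _ => z) hz
      exact ⟨j, z, hj⟩
    have := h5.ncard_pos
    omega
  · rw [he]; exact hmax

end IsExchangeRelation

end OpClone

/-! ### Exchange relations force projections -/

namespace OpClone

namespace IsExchangeRelation

variable {A : Type u} {C : OpClone A} {n : ℕ} {R : Set (Fin n → A)} {ι : Type} [Finite ι]
  {f : (ι → A) → A}

-- Compare `f` with `f(t, …, t)` on separate variables. The active positions of the latter project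
-- onto those of `f`, bijectively by maximality of `f`. So in the `i`-th copy of `t` only one
-- position `d` is active, and activity of the output depends on column `d` alone.
open scoped Classical in
theorem exists_position_iff [Finite A] [Nonempty A] (hC : C.IsCore)
    (hR : C.IsExchangeRelation R) (hf : C.mem f)
    (hmax : ∀ (κ : Type) [Finite κ] (h : (κ → A) → A), C.mem h →
      (activePositions R h).ncard ≤ (activePositions R f).ncard)
    {τ : Type} [Finite τ] {t : (τ → A) → A} (ht : C.mem t) {i : ι}
    (hi : i ∈ activePositions R f) :
    ∃ d : τ, ∀ Z : τ → Fin n → A,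
      Active R f i (rowwise t Z) ↔ Active R f i (fun r => t (fun _ => Z d r)) := by
  obtain ⟨a⟩ := ‹Nonempty A›
  let h : (ι × τ → A) → A := fun x => f (fun i => t (fun l => x (i, l)))
  have hh : C.mem h := C.comp hf (fun i => mem_reindex ht (fun l => (i, l)))
  have hrow : ∀ X : ι × τ → Fin n → A,
      rowwise h X = rowwise f (fun i => rowwise t (fun l => X (i, l))) := fun X => rfl
  have hfst : ∀ j ∈ activePositions R h, j.1 ∈ activePositions R f := by
    rintro ⟨i, l⟩ ⟨c, hc⟩
    have h1 := hc (fun _ => a)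
    rw [hrow] at h1
    refine ⟨_, hR.active_of_not_mem hf h1 (j := i) fun i' hi' => ?_⟩
    refine hR.preserves ht _ fun l' => ?_
    simp only [Prod.mk.injEq, hi', false_and, if_false]
    exact hR.const_mem _
  have hsurj : ∀ i ∈ activePositions R f, ∃ l, (i, l) ∈ activePositions R h := by
    rintro i ⟨c, hc⟩
    obtain ⟨g', hg', -, hg⟩ := (unary_diag ht).exists_inverse hC
    have h1 : rowwise h (fun j => if j.1 = i then fun r => g' (c r) else fun _ => a) ∉ R := by
      rw [hrow]
      convert hc (fun _ => t (fun _ => a)) using 3 with i'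
      ext i' r
      by_cases hi' : i' = i
      · simp only [hi', rowwise, if_true]; exact hg (c r)
      · simp only [hi', rowwise, if_false]
    obtain ⟨⟨i', l⟩, h2, h3⟩ := hR.exists_active hh h1
    by_cases hi' : i' = i
    · subst hi'; exact ⟨l, _, h3⟩
    · simp only [hi', if_false] at h2
      exact absurd (hR.const_mem a) h2
  obtain ⟨d, hd⟩ := hsurj i hi
  have huniq : ∀ l, (i, l) ∈ activePositions R h → l = d := by
    intro l hl
    have := Set.inj_on_of_surj_on_of_ncard_le (s := activePositions R h)
      (t := activePositions R f) (fun j _ => j.1) (fun j hj => hfst j hj)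
      (fun b hb => by obtain ⟨l, hl⟩ := hsurj b hb; exact ⟨_, hl, rfl⟩)
      (hmax _ h hh) hl hd rfl
    exact (Prod.mk.inj this).2
  have key : ∀ Z : τ → Fin n → A, Active R f i (rowwise t Z) ↔ Active R h (i, d) (Z d) := by
    intro Z
    constructor
    · intro h1
      have h2 : rowwise h (fun j => if j.1 = i then Z j.2 else fun _ => a) ∉ R := by
        rw [hrow]
        convert h1 (fun _ => t (fun _ => a)) using 3
        ext i' r
        by_cases hi' : i' = i
        · simp only [hi', rowwise, if_true]
        · simp only [hi', rowwise, if_false]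
      obtain ⟨⟨i', l⟩, h3, h4⟩ := hR.exists_active hh h2
      by_cases hi' : i' = i
      · subst hi'
        obtain rfl := huniq l ⟨_, h4⟩
        simpa using h4
      · simp only [hi', if_false] at h3
        exact absurd (hR.const_mem a) h3
    · intro h1
      have h2 : rowwise h (fun j => if j.1 = i then Z j.2 else fun _ => a) ∉ R := by
        -- The positions `(i, l)` with `l ≠ d` are inactive, so their columns may be changed without
        -- control.
        refine hR.rowwise_not_mem_of_mix (activePositions R h)
          (fun X hX => ?_) (fun s r₁ r hr j hj => ?_) (h1 (fun _ => a))
        · obtain ⟨j, h3, h4⟩ := hR.exists_active hh hX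
          exact ⟨j, ⟨_, h4⟩, h3⟩
        · obtain ⟨i', l⟩ := j
          by_cases hi' : i' = i
          · subst hi'
            obtain rfl := huniq l hj
            simp only [if_true, ite_self]
            exact hR.update_mem_of_ne _ hr rfl
          · simp only [hi', Prod.mk.injEq, false_and, if_false, ite_self]
            exact hR.two_valued_mem a a (fun q => by by_cases hq : q = r <;> simp [hq])
      rw [hrow] at h2
      have h3 := hR.active_of_not_mem hf h2 (j := i) fun i' hi' => by
        refine hR.preserves ht _ fun l' => ?_
        simp only [hi', if_false]
        exact hR.const_mem _
      simpa using h3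
  refine ⟨d, fun Z => ?_⟩
  rw [key, ← key (fun _ => Z d)]
  rfl

/-- An exchange relation forces the clone to act by projections. -/
theorem isDictatorial [Finite A] [Nonempty A] (hC : C.IsCore) (hR : C.IsExchangeRelation R)
    (hne : R ≠ Set.univ) : C.IsDictatorial := by
  classical
  obtain ⟨ι, _, f, hf, hid, ⟨i₀, hi₀⟩, hmax⟩ := hR.exists_idempotent_max hC hne
  obtain ⟨a⟩ := ‹Nonempty A›
  have hconst : ∀ i : ι, ¬ Active R f i (fun _ => a) := fun i hi =>
    hi (fun _ => a) (by simp only [ite_self]; exact hR.const_mem (f fun _ => a))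
  have hdiag : ∀ y : Fin n → A, rowwise f (fun _ => y) = y := fun y => by
    ext r; exact hid _
  -- The selection principle is applied to `f` itself.
  choose! π hπ using fun (i : ι) (hi : i ∈ activePositions R f) =>
    hR.exists_position_iff hC hf hmax hf hi
  have hπ' : ∀ i ∈ activePositions R f, ∀ Z : ι → Fin n → A,
      Active R f i (rowwise f Z) ↔ Active R f i (Z (π i)) := by
    intro i hi Z
    rw [hπ i hi]
    simp only [hid]
  have hsub : ∀ i c, Active R f i c → Active R f (π i) c := by
    intro i c hc
    have hi : i ∈ activePositions R f := ⟨c, hc⟩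
    have h1 : Active R f i (rowwise f (fun j => if j = π i then c else fun _ => a)) := by
      rw [hπ' i hi]; simpa using hc
    have h3 := hR.active_of_not_mem hf (hR.not_mem_of_active hf h1) (j := π i) fun j hj => by
      simp only [hj, if_false]; exact hR.const_mem a
    simpa using h3
  let y : ι → (Fin n → A) → Fin n → A := fun l z =>
    rowwise f (fun j => if j = l then z else fun _ => a)
  have hy : ∀ l z i, Active R f i (y l z) → π i = l ∧ Active R f i z := by
    intro l z i h1
    have h2 := (hπ' i ⟨_, h1⟩ _).1 h1
    by_cases h3 : π i = l
    · simp only [h3, if_true] at h2; exact ⟨h3, h2⟩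
    · simp only [h3, if_false] at h2; exact absurd h2 (hconst i)
  have hex : ∀ l z, Active R f l z → ∃ i, Active R f i (y l z) := by
    intro l z h1
    have h2 : rowwise f (fun _ => y l z) ∉ R := by rw [hdiag]; exact h1 _
    obtain ⟨i, -, h3⟩ := hR.exists_active hf h2
    exact ⟨i, h3⟩
  -- By `hex` and `hy`, `π` maps the finite set of active positions onto itself.
  have hinj : ∀ i ∈ activePositions R f, ∀ j ∈ activePositions R f, π i = π j → i = j := by
    intro i hi j hj hij
    refine Set.inj_on_of_surj_on_of_ncard_le (s := activePositions R f)
      (t := activePositions R f) (fun i _ => π i) (fun i ⟨c, hc⟩ => ⟨c, hsub i c hc⟩)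
      (fun l ⟨c, hc⟩ => ?_) le_rfl hi hj hij
    obtain ⟨i, h1⟩ := hex l c hc
    exact ⟨i, ⟨_, h1⟩, (hy _ _ _ h1).1⟩
  -- Applying `g` in argument `i` of `f` only gives, on the diagonal, a unary operation, which
  -- preserves non-membership in `R`. Injectivity of `π` leaves `i` as the only possible active
  -- position.
  have hstable : ∀ l z g, C.Unary g → Active R f l z → Active R f l (fun r => g (z r)) := by
    intro l z g hg hz
    obtain ⟨i, h1⟩ := hex l z hz
    obtain ⟨hil, h2⟩ := hy l z i h1
    have h3 : Active R f i (fun r => g (y l z r)) := by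
      have hu : C.Unary (fun a => f (fun j => if j = i then g a else a)) := by
        have := mem_comp_unary hf (g := fun j => if j = i then g else fun a => a) (fun j => by
          by_cases hj : j = i
          · simpa [hj] using hg
          · simpa [hj] using unary_id)
        have := unary_diag this
        convert this using 4
        split_ifs <;> rfl
      have h4 : rowwise f (fun j => if j = i then fun r => g (y l z r) else y l z) ∉ R := by
        have h5 : y l z ∉ R := hz _
        rw [← hR.unary_mem_iff hC hu] at h5
        convert h5 using 2
        ext r
        simp only [rowwise]
        congr 1
        ext j
        split_ifs <;> rfl
      obtain ⟨i', -, h6⟩ := hR.exists_active hf h4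
      by_cases hi' : i' = i
      · subst hi'; simpa using h6
      · simp only [hi', if_false] at h6
        exact absurd (hinj _ ⟨_, h6⟩ _ ⟨_, h1⟩ ((hy _ _ _ h6).1.trans hil.symm)) hi'
    -- Selection for `g ∘ f` passes from `y l z` back to `z`; a position other than `l` would make a
    -- constant column active.
    obtain ⟨d, hd⟩ := hR.exists_position_iff hC hf hmax (hg.mem_comp hf) (i := i) ⟨_, h1⟩
    have h4 := (hd (fun j => if j = l then z else fun _ => a)).1 h3
    simp only [hid] at h4
    by_cases hdl : d = l
    · simp only [hdl, if_true] at h4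
      exact hil ▸ hsub _ _ h4
    · simp only [hdl, if_false] at h4
      exact absurd h4 fun h5 =>
        h5 (fun _ => g a) (by simp only [ite_self]; exact hR.const_mem (f fun _ => g a))
  refine ⟨n, Set.univ, {c | Active R f i₀ c}, Set.subset_univ _, hi₀,
    ⟨fun _ => a, trivial, hconst i₀⟩, fun τ _ t ht => ?_⟩
  obtain ⟨d, hd⟩ := hR.exists_position_iff hC hf hmax ht hi₀
  refine ⟨d, fun Z _ => ⟨trivial, ?_⟩⟩
  obtain ⟨g', hg', h1, -⟩ := (unary_diag ht).exists_inverse hC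
  refine (hd Z).trans ⟨fun h2 => ?_, fun h2 => hstable _ _ _ (unary_diag ht) h2⟩
  simpa only [h1, Set.mem_ofPred_eq] using hstable _ _ _ hg' h2

end IsExchangeRelation

end OpClone

/-! ### Absorption and centers -/

namespace OpClone

variable {A : Type u} (C : OpClone A)

/-- A subuniverse: a set closed under all operations of the clone. -/
def Closed (B : Set A) : Prop :=
  ∀ ⦃ι : Type⦄ [Finite ι] ⦃f : (ι → A) → A⦄, C.mem f → ∀ x : ι → A, (∀ i, x i ∈ B) → f x ∈ B

/-- A set closed under all idempotent operations of the clone. -/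
def IdempotentClosed (B : Set A) : Prop :=
  ∀ ⦃ι : Type⦄ [Finite ι] ⦃f : (ι → A) → A⦄, C.mem f → (∀ a, f (fun _ => a) = a) →
    ∀ x : ι → A, (∀ i, x i ∈ B) → f x ∈ B

/-- Invariance of a binary relation. -/
def PreservesRel (E : A → A → Prop) : Prop :=
  ∀ ⦃ι : Type⦄ [Finite ι] ⦃f : (ι → A) → A⦄, C.mem f →
    ∀ x y : ι → A, (∀ i, E (x i) (y i)) → E (f x) (f y)

/-- `t` witnesses that `Z` absorbs `B`: if all arguments but one are in `Z`, and the
remaining one is in `B`, then the value is in `Z`. -/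
def AbsorbsVia {ι : Type} (t : (ι → A) → A) (Z B : Set A) : Prop :=
  ∀ i (x : ι → A), x i ∈ B → (∀ k, k ≠ i → x k ∈ Z) → t x ∈ Z

/-- `Z` absorbs `B` by means of an idempotent operation of the clone. -/
def Absorbs (Z B : Set A) : Prop :=
  ∃ (ι : Type) (_ : Finite ι) (t : (ι → A) → A),
    C.mem t ∧ (∀ a, t (fun _ => a) = a) ∧ AbsorbsVia t Z B

/-- The subuniverse generated by `Z` and `x`. -/
def adjoin (Z : Set A) (x : A) : Set A :=
  {y | ∃ (ι : Type) (_ : Finite ι) (f : (ι → A) → A) (v : ι → A),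
    C.mem f ∧ (∀ i, v i ∈ Z ∨ v i = x) ∧ f v = y}

variable {C}

theorem Closed.unary {B : Set A} (hB : C.Closed B) {g : A → A} (hg : C.Unary g) {a : A}
    (ha : a ∈ B) : g a ∈ B :=
  hB hg (fun _ => a) (fun _ => ha)

theorem star_mem {ι κ : Type} {s : (ι → A) → A} {t : (κ → A) → A} (hs : C.mem s)
    (ht : C.mem t) : C.mem (fun x : ι × κ → A => s (fun i => t (fun k => x (i, k)))) :=
  C.comp hs (fun i => mem_reindex ht (fun k => (i, k)))

theorem closed_adjoin (Z : Set A) (x : A) : C.Closed (C.adjoin Z x) := by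
  intro ι _ f hf y hy
  choose κ hκ s v hs hv hy using hy
  refine ⟨Σ i, κ i, inferInstance, fun w => f (fun i => s i (fun l => w ⟨i, l⟩)),
    fun w => v w.1 w.2, C.comp hf fun i => mem_reindex (hs i) _, fun w => hv _ _, ?_⟩
  simp only [hy]

theorem subset_adjoin (Z : Set A) (x : A) : Z ⊆ C.adjoin Z x :=
  fun z hz => ⟨Unit, inferInstance, _, fun _ => z, C.proj (), fun _ => Or.inl hz, rfl⟩

theorem mem_adjoin (Z : Set A) (x : A) : x ∈ C.adjoin Z x :=
  ⟨Unit, inferInstance, _, fun _ => x, C.proj (), fun _ => Or.inr rfl, rfl⟩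

theorem Closed.adjoin_subset {Z B : Set A} (hB : C.Closed B) (hZ : Z ⊆ B) {x : A} (hx : x ∈ B) :
    C.adjoin Z x ⊆ B := by
  rintro _ ⟨ι, _, f, v, hf, hv, rfl⟩
  refine hB hf v fun i => ?_
  rcases hv i with h | h
  · exact hZ h
  · exact h ▸ hx

/-- In `s(t, …, t)` an exceptional argument spoils one inner block: `t` repairs it for `B₂`, while
`s` tolerates it for `B₁`. -/
theorem Absorbs.inter {B₁ B₂ : Set A} (h₁ : C.Absorbs B₁ Set.univ) (h₂ : C.Absorbs B₂ Set.univ)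
    (c₁ : C.IdempotentClosed B₁) (c₂ : C.IdempotentClosed B₂) :
    C.Absorbs (B₁ ∩ B₂) Set.univ := by
  obtain ⟨ι, _, s, hs, si, sa⟩ := h₁
  obtain ⟨κ, _, t, ht, ti, ta⟩ := h₂
  refine ⟨ι × κ, inferInstance, _, star_mem hs ht, fun a => ?_, ?_⟩
  · simp only [ti, si]
  · rintro ⟨i, k⟩ x - hx
    have h1 : ∀ i', i' ≠ i → t (fun k => x (i', k)) ∈ B₁ := fun i' hi' =>
      c₁ ht ti _ fun k' => (hx (i', k') (by simp [hi'])).1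
    have h2 : ∀ i', t (fun k => x (i', k)) ∈ B₂ := by
      intro i'
      by_cases hi' : i' = i
      · subst hi'
        exact ta k _ trivial fun k' hk' => (hx (i', k') (by simp [hk'])).2
      · exact c₂ ht ti _ fun k' => (hx (i', k') (by simp [hi'])).2
    exact ⟨sa i _ trivial h1, c₂ hs si _ h2⟩

/-- If the exceptional argument is in `B₁`, its inner block stays in `B₁` by `hB` and the outer `s`
absorbs it; if it is in `B₂`, the inner `t` absorbs it already. -/
theorem Absorbs.union {Z B₁ B₂ : Set A} (h₁ : C.Absorbs Z B₁) (h₂ : C.Absorbs Z B₂)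
    (hZ : C.Closed Z) (hB : ∀ x ∈ B₁, C.adjoin Z x ⊆ B₁) : C.Absorbs Z (B₁ ∪ B₂) := by
  obtain ⟨ι, _, s, hs, si, sa⟩ := h₁
  obtain ⟨κ, _, t, ht, ti, ta⟩ := h₂
  refine ⟨ι × κ, inferInstance, _, star_mem hs ht, fun a => ?_, ?_⟩
  · simp only [ti, si]
  · rintro ⟨i, k⟩ x hik hx
    have h1 : ∀ i', i' ≠ i → t (fun k => x (i', k)) ∈ Z := fun i' hi' =>
      hZ ht _ fun k' => hx (i', k') (by simp [hi'])
    rcases hik with hik | hik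
    · refine sa i _ (hB _ hik ?_) h1
      refine ⟨κ, inferInstance, t, _, ht, fun k' => ?_, rfl⟩
      by_cases hk : k' = k
      · exact Or.inr (by rw [hk])
      · exact Or.inl (hx (i, k') (by simp [hk]))
    · refine hZ hs _ fun i' => ?_
      by_cases hi' : i' = i
      · subst hi'
        exact ta k _ hik fun k' hk' => hx (i', k') (by simp [hk'])
      · exact h1 i' hi'

theorem closed_center [Finite A] (hC : C.IsCore) {E : A → A → Prop} (hE : C.PreservesRel E) :
    C.Closed {z | ∀ y, E z y} := by
  intro ι _ f hf x hx y
  obtain ⟨g, g', hg, hg', h1, h2, h3, h4⟩ := exists_idempotent hC hf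
  have := hE hf x (fun _ => g' y) (fun i => hx i _)
  rwa [h3, h2] at this

theorem idempotentClosed_neighbors {E : A → A → Prop} (hE : C.PreservesRel E) (a : A) :
    C.IdempotentClosed {b | E a b} := by
  intro ι _ f hf hid x hx
  have := hE hf (fun _ => a) x hx
  rwa [hid] at this

theorem absorbs_iInter_neighbors [Finite A] {E : A → A → Prop} (hE : C.PreservesRel E)
    (O : Set A) (hO : ∀ a ∈ O, C.Absorbs {b | E a b} Set.univ) :
    C.Absorbs {b | ∀ a ∈ O, E a b} Set.univ := by
  induction O, Set.toFinite O using Set.Finite.induction_on with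
  | empty => exact ⟨Unit, inferInstance, _, C.proj (), fun _ => rfl, fun _ _ _ _ => by simp⟩
  | @insert a s _ _ ih =>
    have h1 := (hO a (Set.mem_insert _ _)).inter (ih fun b hb => hO b (Set.mem_insert_of_mem _ hb))
      (idempotentClosed_neighbors hE a) (by
        intro ι _ f hf hid x hx b hb
        exact idempotentClosed_neighbors hE b hf hid x fun i => hx i b hb)
    convert h1 using 1
    ext b
    simp

/-- Two values outside `N` obtained from complementary blocks of central elements make a
neighborhood with the maximal number of elements absorbing. -/
theorem absorbs_neighbors [Finite A] (hC : C.IsCore) {E : A → A → Prop}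
    (hE : C.PreservesRel E) {Z M : Set A} (hZE : ∀ z ∈ Z, ∀ y, E z y) (hZ : C.Closed Z)
    (hM : ∀ g, C.Unary g → ∀ a ∈ M, g a ∈ M) {a : A}
    (hmax : ∀ b ∈ M, {c | E b c}.ncard ≤ {c | E a c}.ncard)
    {ι : Type} [Finite ι] {f : (ι → A) → A} (hf : C.mem f) (J : Set ι) (x y : ι → A)
    (hxJ : ∀ i ∈ J, x i ∈ Z) (hyJ : ∀ i ∉ J, y i ∈ Z) (hx : ∀ i, x i ∈ C.adjoin Z a)
    (hy : ∀ i, y i ∈ C.adjoin Z a) (hfx : f x ∈ M) (hfy : f y ∈ M) :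
    C.Absorbs {b | E a b} Set.univ := by
  classical
  have hw : ∀ i, (if i ∈ J then y i else x i) ∈ C.adjoin Z a := fun i => by
    split_ifs
    exacts [hy i, hx i]
  choose κ hκ s v hs hv hsv using hw
  choose g g' hg hg' h1 h2 h3 h4 using fun i => exists_idempotent hC (hs i)
  let F : ((Σ i, κ i) → A) → A := fun w => f (fun i => s i (fun l => w ⟨i, l⟩))
  have hF : C.mem F := C.comp hf fun i => mem_reindex (hs i) _
  -- Arguments in non-central blocks are expanded into generators from `Z` and `a`; in central
  -- blocks the twist by `g'` cancels the diagonal of `s i`.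
  let x' : (Σ i, κ i) → A := fun k => if k.1 ∈ J then g' k.1 (x k.1) else v k.1 k.2
  let y' : (Σ i, κ i) → A := fun k => if k.1 ∈ J then v k.1 k.2 else g' k.1 (y k.1)
  have hFx : F x' = f x := by
    simp only [F, x']
    congr 1
    ext i
    by_cases hi : i ∈ J
    · simp only [hi, if_true, h3, h2]
    · simp only [hi, if_false]
      simpa [hi] using hsv i
  have hFy : F y' = f y := by
    simp only [F, y']
    congr 1
    ext i
    by_cases hi : i ∈ J
    · simp only [hi, if_true]
      simpa [hi] using hsv i
    · simp only [hi, if_false, h3, h2]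
  obtain ⟨q, q', hq, hq', e1, e2, e3, ht⟩ := exists_idempotent hC hF
  have hid : ∀ a, q' (F fun _ => a) = a := fun a => by rw [e3, e1]
  have hadj : ∀ i l b, E a b → E (v i l) b := by
    intro i l b hb
    rcases hv i l with h | h
    · exact hZE _ h _
    · rwa [h]
  have side : ∀ (z : (Σ i, κ i) → A) (J' : Set (Σ i, κ i)), F z ∈ M →
      (∀ k ∈ J', z k ∈ Z) → (∀ k ∉ J', ∀ b, E a b → E (z k) b) →
      ∀ u : (Σ i, κ i) → A, (∀ k ∉ J', E a (u k)) → E a (q' (F u)) := by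
    intro z J' hz hz1 hz2 u hu
    have key : ∀ u : (Σ i, κ i) → A, (∀ k ∉ J', E a (u k)) → E (q' (F z)) (q' (F u)) := by
      intro u hu
      refine hE ht z u fun k => ?_
      by_cases hk : k ∈ J'
      · exact hZE _ (hz1 k hk) _
      · exact hz2 k hk _ (hu k hk)
    have hsub : {c | E a c} ⊆ {c | E (q' (F z)) c} := by
      intro c hc
      have := key (fun _ => c) (fun _ _ => hc)
      rwa [hid] at this
    -- The neighborhood of `a` lies in that of a point of `M`, so maximality makes them equal.
    have heq := Set.eq_of_subset_of_ncard_le hsub (hmax _ (hM _ hq' _ hz))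
    have h5 : q' (F u) ∈ {c | E (q' (F z)) c} := key u hu
    rwa [← heq] at h5
  refine ⟨_, inferInstance, _, ht, hid, fun k u _ hu => ?_⟩
  -- The exceptional argument lies in a block where `x'` or `y'` is central, and that tuple is
  -- related to `u` coordinatewise.
  by_cases hk : k.1 ∈ J
  · refine side x' {k | k.1 ∈ J} (hFx ▸ hfx) (fun k hk => ?_) (fun k hk b hb => ?_) u
      fun k' hk' => hu k' fun h => hk' (h ▸ hk)
    · have hk : k.1 ∈ J := hk
      simp only [x', hk, if_true]
      exact hZ.unary (hg' _) (hxJ _ hk)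
    · have hk : k.1 ∉ J := hk
      simp only [x', hk, if_false]
      exact hadj _ _ _ hb
  · refine side y' {k | k.1 ∉ J} (hFy ▸ hfy) (fun k hk => ?_) (fun k hk b hb => ?_) u
      fun k' hk' => hu k' fun h => hk' (h ▸ hk)
    · have hk : k.1 ∉ J := hk
      simp only [y', hk, if_false]
      exact hZ.unary (hg' _) (hyJ _ hk)
    · have hk : k.1 ∈ J := not_not.1 hk
      simp only [y', hk, if_true]
      exact hadj _ _ _ hb

end OpClone

/-! ### From a center to projections or absorption -/

namespace OpClone

variable {A : Type u} {C : OpClone A}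

/-- `f` takes no value in `M` on arguments from `B` whose coordinates in `J` belong to `Z`. -/
def Avoids (Z B M : Set A) {ι : Type} (f : (ι → A) → A) (J : Set ι) : Prop :=
  ∀ x : ι → A, (∀ i ∈ J, x i ∈ Z) → (∀ i, x i ∈ B) → f x ∉ M

/-- If every operation of arity at least one avoids `M` either on `J` or on the complement of
`J`, but never on all complements of singletons, then the clone acts by projections. -/
theorem isDictatorial_of_avoids [Finite A] {Z B M N : Set A}
    (hZ : C.Closed Z) (hB : C.Closed B) (hZB : Z ⊆ B) (hMB : M ⊆ B) (hN : B \ M ⊆ N)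
    (hMN : Disjoint M N) (hadj : ∀ x ∈ N, C.adjoin Z x ⊆ N) (hZne : Z.Nonempty)
    (hMne : M.Nonempty)
    (hdich : ∀ (ι : Type) [Finite ι] (f : (ι → A) → A), C.mem f → ∀ J : Set ι,
      Avoids Z B M f J ∨ Avoids Z B M f Jᶜ)
    (hex : ∀ (ι : Type) [Finite ι] (f : (ι → A) → A), C.mem f → ∃ l, ¬ Avoids Z B M f {l}ᶜ) :
    C.IsDictatorial := by
  have hmono : ∀ {ι : Type} {f : (ι → A) → A} {J J' : Set ι}, J ⊆ J' → Avoids Z B M f J →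
      Avoids Z B M f J' := fun h hJ x hx => hJ x fun i hi => hx i (h hi)
  have hpos : ∀ {ι : Type} [Finite ι] {f : (ι → A) → A}, C.mem f → ∀ l,
      ¬ Avoids Z B M f {l}ᶜ → Avoids Z B M f {l} := by
    intro ι _ f hf l hl
    exact (hdich ι f hf {l}).resolve_right hl
  have huniq : ∀ {ι : Type} [Finite ι] {f : (ι → A) → A}, C.mem f → ∀ l l',
      Avoids Z B M f {l} → ¬ Avoids Z B M f {l'}ᶜ → l = l' := by
    intro ι _ f hf l l' hl hl'
    by_contra h
    exact hl' (hmono (by simpa using Ne.symm h) hl)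
  -- A position `l` with `¬ Avoids Z B M f {l}ᶜ` is the unique dictator of `f`. To see that
  -- dictators compose, the inner operations first get separate variables, which are then
  -- identified.
  have hcomp : ∀ {ι κ : Type} [Finite ι] [Finite κ] {f : (ι → A) → A} {b : ι → (κ → A) → A},
      C.mem f → (∀ i, C.mem (b i)) → ∀ i p, ¬ Avoids Z B M f {i}ᶜ → ¬ Avoids Z B M (b i) {p}ᶜ →
      ¬ Avoids Z B M (fun x => f fun i => b i x) {p}ᶜ := by
    intro ι κ _ _ f b hf hb i p hi hp
    let h : (ι × κ → A) → A := fun x => f fun i => b i fun k => x (i, k)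
    have hh : C.mem h := C.comp hf fun i => mem_reindex (hb i) _
    obtain ⟨⟨i', p'⟩, h1⟩ := hex _ h hh
    have h2 : i' = i ∧ p' = p := by
      have h1' := h1
      simp only [Avoids, not_forall, not_not] at h1'
      obtain ⟨x, hx1, hx2, hx3⟩ := h1'
      have h3 : ∀ j, j ≠ i' → b j (fun k => x (j, k)) ∈ Z := fun j hj =>
        hZ (hb j) _ fun k => hx1 (j, k) (by simp [hj])
      have h4 : ∀ j, b j (fun k => x (j, k)) ∈ B := fun j => hB (hb j) _ fun k => hx2 _
      have h5 : i = i' := by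
        refine huniq hf i i' (hpos hf i hi) fun h6 => ?_
        exact h6 _ (fun j hj => h3 j hj) h4 hx3
      subst h5
      refine ⟨rfl, (huniq (hb i) p p' (hpos (hb i) p hp) fun h6 => ?_).symm⟩
      have h7 := h6 (fun k => x (i, k)) (fun k hk => hx1 (i, k) (by simpa using hk))
        fun k => hx2 _
      have h8 : h x ∈ N := by
        refine hadj _ (hN ⟨h4 i, h7⟩) ⟨ι, inferInstance, f, _, hf, fun j => ?_, rfl⟩
        by_cases hj : j = i
        · subst hj; exact Or.inr rfl
        · exact Or.inl (h3 j hj)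
      exact Set.disjoint_left.1 hMN hx3 h8
    obtain ⟨rfl, rfl⟩ := h2
    intro h3
    have h4 := hpos hh _ h1
    have hw : C.mem (fun x => f fun i => b i x) := C.comp hf hb
    obtain ⟨l, hl⟩ := hex _ _ hw
    have h5 : p' = l := by
      refine huniq hw p' l (fun x hx1 hx2 => ?_) hl
      exact h4 (fun k => x k.2) (fun k hk => by
        obtain rfl : k = (i', p') := hk
        exact hx1 _ rfl) fun k => hx2 _
    exact hl (h5 ▸ h3)
  have hproj : ∀ {κ : Type} (p : κ), ¬ Avoids Z B M (fun x : κ → A => x p) {p}ᶜ := by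
    classical
    intro κ p h
    obtain ⟨z, hz⟩ := hZne
    obtain ⟨m, hm⟩ := hMne
    refine h (fun k => if k = p then m else z) (fun k hk => ?_) (fun k => ?_) (by simpa using hm)
    · have hk : k ≠ p := hk
      simpa [hk] using hz
    · split_ifs
      exacts [hMB hm, hZB hz]
  -- `U` consists of the value tables of binary operations of the clone, and `S` of those governed
  -- by their first argument.
  obtain ⟨d, ⟨e⟩⟩ := Finite.exists_equiv_fin (Fin 2 → A)
  refine ⟨d, {u | C.mem fun x => u (e x)},
    {u | C.mem (fun x => u (e x)) ∧ ¬ Avoids Z B M (fun x => u (e x)) {0}ᶜ},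
    fun u hu => hu.1, ⟨fun k => e.symm k 0, ?_⟩, ⟨fun k => e.symm k 1, ?_, ?_⟩,
    fun ι _ f hf => ?_⟩
  · simp only [Set.mem_ofPred_eq, Equiv.symm_apply_apply]
    exact ⟨C.proj _, hproj _⟩
  · simp only [Set.mem_ofPred_eq, Equiv.symm_apply_apply]
    exact C.proj _
  · simp only [Set.mem_ofPred_eq, Equiv.symm_apply_apply, not_and, not_not]
    intro h
    refine hmono ?_ (hpos h 1 (hproj _))
    simp
  · obtain ⟨j, hj⟩ := hex ι f hf
    refine ⟨j, fun X hX => ?_⟩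
    have hw : C.mem (fun x => rowwise f X (e x)) := C.comp hf hX
    refine ⟨hw, ?_⟩
    obtain ⟨p, hp⟩ := hex _ _ (hX j)
    have h1 := hcomp hf hX j p hj hp
    constructor
    · rintro ⟨-, h2⟩
      obtain rfl := huniq hw p 0 (hpos hw p h1) h2
      exact ⟨hX j, hp⟩
    · rintro ⟨h3, h2⟩
      obtain rfl := huniq h3 p 0 (hpos h3 p hp) h2
      exact ⟨hw, h1⟩

/-- A proper symmetric invariant relation with a nonempty center either forces the clone to act
by projections, or yields a proper absorbing subuniverse. -/
theorem isDictatorial_or_exists_absorbs [Finite A] (hC : C.IsCore) {E : A → A → Prop}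
    (hE : C.PreservesRel E) (hsymm : ∀ a b, E a b → E b a) (hcenter : ∃ z, ∀ y, E z y)
    (hproper : ∃ a b, ¬ E a b) :
    C.IsDictatorial ∨ ∃ Y : Set A, C.Closed Y ∧ Y.Nonempty ∧ Y ≠ Set.univ ∧
      C.Absorbs Y Set.univ := by
  let Z : Set A := {z | ∀ y, E z y}
  have hZ : C.Closed Z := closed_center hC hE
  have hZne : Z.Nonempty := hcenter
  have hZu : Z ≠ Set.univ := by
    obtain ⟨a, b, hab⟩ := hproper
    intro h
    have : a ∈ Z := h ▸ trivial
    exact hab (this b)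
  -- Closure under adjoining one element at a time, unlike being a subuniverse, survives unions;
  -- this lets a maximal `N` be enlarged by `B` in `hBabs`.
  let T : Set (Set A) := {N | Z ⊆ N ∧ (∀ x ∈ N, C.adjoin Z x ⊆ N) ∧ C.Absorbs Z N}
  have hTZ : Z ∈ T := ⟨subset_rfl, fun x hx => hZ.adjoin_subset subset_rfl hx,
    Unit, inferInstance, _, C.proj (), fun _ => rfl, fun i x hx _ => by simpa using hx⟩
  obtain ⟨N, ⟨hZN, hadj, habs⟩, hNmax⟩ := (Set.toFinite T).exists_maximal ⟨Z, hTZ⟩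
  by_cases hNu : N = Set.univ
  · exact Or.inr ⟨Z, hZ, hZne, hZu, hNu ▸ habs⟩
  obtain ⟨x, hxN, hxmin⟩ := Set.exists_min_image Nᶜ (fun x => (C.adjoin Z x).ncard)
    (Set.toFinite _) (Set.nonempty_compl.2 hNu)
  let B := C.adjoin Z x
  have hB : C.Closed B := closed_adjoin Z x
  have hZB : Z ⊆ B := subset_adjoin Z x
  let M := B \ N
  have hgen : ∀ a ∈ M, C.adjoin Z a = B := fun a ha =>
    Set.eq_of_subset_of_ncard_le (hB.adjoin_subset hZB ha.1) (hxmin a ha.2)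
  have hMu : ∀ g, C.Unary g → ∀ a ∈ M, g a ∈ M := by
    intro g hg a ha
    obtain ⟨g', hg', h1, h2⟩ := hg.exists_inverse hC
    refine ⟨hB.unary hg ha.1, fun h => ha.2 ?_⟩
    rw [← h1 a]
    exact hadj _ h ((closed_adjoin Z (g a)).unary hg' (mem_adjoin _ _))
  have hBabs : ¬ C.Absorbs Z B := by
    intro h
    have h1 : N ∪ B ∈ T := by
      refine ⟨hZN.trans Set.subset_union_left, ?_, habs.union h hZ hadj⟩
      rintro y (hy | hy)
      · exact (hadj y hy).trans Set.subset_union_left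
      · exact (hB.adjoin_subset hZB hy).trans Set.subset_union_right
    exact hxN (hNmax h1 Set.subset_union_left (Or.inr (mem_adjoin Z x)))
  have hMne : M.Nonempty := ⟨x, mem_adjoin Z x, hxN⟩
  -- Either two complementary blocks of central arguments both allow values in `M`, giving
  -- absorption, or this never happens, giving dictators.
  by_cases hQ : ∃ (ι : Type) (_ : Finite ι) (f : (ι → A) → A) (J : Set ι) (x y : ι → A),
      C.mem f ∧ (∀ i ∈ J, x i ∈ Z) ∧ (∀ i ∉ J, y i ∈ Z) ∧ (∀ i, x i ∈ B) ∧ (∀ i, y i ∈ B) ∧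
        f x ∈ M ∧ f y ∈ M
  · obtain ⟨ι, _, f, J, u, v, hf, hu, hv, hu', hv', hfu, hfv⟩ := hQ
    let O : Set A := {a | a ∈ M ∧ ∀ b ∈ M, {c | E b c}.ncard ≤ {c | E a c}.ncard}
    obtain ⟨a, ha⟩ : O.Nonempty := by
      obtain ⟨a, h1, h2⟩ := Set.exists_max_image M (fun a => {c | E a c}.ncard)
        (Set.toFinite _) hMne
      exact ⟨a, h1, h2⟩
    have hO : ∀ g, C.Unary g → ∀ a ∈ O, g a ∈ O := by
      rintro g hg a ⟨h1, h2⟩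
      refine ⟨hMu g hg a h1, fun b hb => (h2 b hb).trans ?_⟩
      rw [← Set.ncard_image_of_injective _ (hC g hg)]
      refine Set.ncard_le_ncard ?_
      rintro _ ⟨c, hc, rfl⟩
      exact hE hg (fun _ => a) (fun _ => c) fun _ => hc
    -- One neighborhood is only known to be closed under idempotent operations; intersecting over
    -- `O`, which is stable under unary operations, gives a subuniverse.
    refine Or.inr ⟨{b | ∀ a ∈ O, E a b}, ?_, ?_, ?_, absorbs_iInter_neighbors hE O ?_⟩
    · intro ι _ f hf y hy a ha
      obtain ⟨g, g', hg, hg', h1, h2, h3, h4⟩ := exists_idempotent hC hf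
      have := hE hf (fun _ => g' a) y fun i => hy i _ (hO g' hg' a ha)
      rwa [h3, h2] at this
    · obtain ⟨z, hz⟩ := hZne
      exact ⟨z, fun a _ => hsymm _ _ (hz a)⟩
    · intro h
      have h1 : a ∉ Z := fun h => ha.1.2 (hZN h)
      apply h1
      intro y
      have h2 : y ∈ {b | ∀ a ∈ O, E a b} := h ▸ trivial
      exact h2 a ha
    · intro a ha
      exact absorbs_neighbors hC hE (fun z hz => hz) hZ hMu ha.2 hf J u v hu hv
        (fun i => hgen a ha.1 ▸ hu' i) (fun i => hgen a ha.1 ▸ hv' i) hfu hfv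
  · left
    refine isDictatorial_of_avoids hZ hB hZB Set.sdiff_subset (N := N)
      (fun y hy => by_contra fun h => hy.2 ⟨hy.1, h⟩) Set.disjoint_sdiff_left hadj hZne hMne
      ?_ ?_
    · intro ι _ f hf J
      by_contra! h
      simp only [Avoids, not_forall, not_not] at h
      obtain ⟨⟨u, hu, hu', hfu⟩, ⟨v, hv, hv', hfv⟩⟩ := h
      exact hQ ⟨ι, inferInstance, f, J, u, v, hf, hu, hv, hu', hv', hfu, hfv⟩
    · intro ι _ f hf
      by_contra! h
      apply hBabs
      obtain ⟨g, g', hg, hg', h1, h2, h3, h4⟩ := exists_idempotent hC hf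
      obtain ⟨κ, _, s, hs, si, sa⟩ := habs
      -- If no position is a dictator, the inner operation sends the exceptional block into `N`,
      -- from where `s` absorbs it into `Z`.
      refine ⟨κ × ι, inferInstance, _, star_mem hs h4, fun a => ?_, ?_⟩
      · simp only [h3, h1, si]
      · rintro ⟨k, i⟩ y hy hy'
        refine sa k _ ?_ fun k' hk' => hZ h4 _ fun i' => hy' (k', i') (by simp [hk'])
        have hyB : ∀ i', y (k, i') ∈ B := fun i' => by
          by_cases hi : i' = i
          · exact hi ▸ hy
          · exact hZB (hy' _ (by simp [hi]))
        have h5 := h i (fun i => y (k, i)) (fun i' hi' => hy' (k, i') (by simpa using hi')) hyB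
        by_contra h6
        apply h5
        have h7 := hMu g hg _ ⟨hB h4 _ hyB, h6⟩
        rwa [h2] at h7

end OpClone

/-! ### Invariant simplicial complexes of a digraph -/

namespace OpClone

variable {A : Type u} {C : OpClone A} {D : Digraph A} {K : Set (Set A)}

/-- An invariant simplicial complex that contains all vertices and all links of a digraph, but
is not full. -/
structure IsLinkComplex (C : OpClone A) (D : Digraph A) (K : Set (Set A)) : Prop where
  down : ∀ X ∈ K, ∀ Y ⊆ X, Y ∈ K
  preserves : ∀ ⦃ι : Type⦄ [Finite ι] ⦃f : (ι → A) → A⦄, C.mem f → ∀ W : Set (ι → A),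
    (∀ i, (fun x => x i) '' W ∈ K) → f '' W ∈ K
  singleton : ∀ a, {a} ∈ K
  link : ∀ x y, D.Link x y → {x, y} ∈ K
  proper : Set.univ ∉ K

/-- The sets all of whose subsets with less than `n` elements can be extended within `K` by a
common vertex. -/
def cone (n : ℕ) (K : Set (Set A)) : Set (Set A) :=
  {X | ∃ u, ∀ Y ⊆ X, Y.ncard < n → insert u Y ∈ K}

theorem isLinkComplex_of_digraph (hD : C.PreservesRel D.Adj) (hs : D.IsSmooth)
    (hl : D.IsLoopless) : C.IsLinkComplex D {X | ∃ z, ∀ x ∈ X, D.Adj x z} where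
  down := fun X ⟨z, hz⟩ Y hY => ⟨z, fun x hx => hz x (hY hx)⟩
  preserves := by
    intro ι _ f hf W hW
    choose z hz using hW
    refine ⟨f z, ?_⟩
    rintro _ ⟨w, hw, rfl⟩
    exact hD hf w z fun i => hz i _ ⟨w, hw, rfl⟩
  singleton := fun a => by simpa using hs.1 a
  link := fun x y ⟨z, hx, hy⟩ => ⟨z, by simp [hx, hy]⟩
  proper := fun ⟨z, hz⟩ => hl z (hz z trivial)

namespace IsLinkComplex

theorem subset_cone [Nonempty A] (hK : C.IsLinkComplex D K) (n : ℕ) : K ⊆ cone n K := by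
  intro X hX
  obtain rfl | ⟨u, hu⟩ := X.eq_empty_or_nonempty
  · obtain ⟨a⟩ := ‹Nonempty A›
    refine ⟨a, fun Y hY _ => ?_⟩
    rw [Set.subset_empty_iff.1 hY]
    simpa using hK.singleton a
  · exact ⟨u, fun Y hY _ => hK.down X hX _ (Set.insert_subset hu hY)⟩

/-- The apex for an image is `f` of the apexes. A small subset of the image lifts pointwise to a set
whose projections are no larger. -/
theorem cone_isLinkComplex [Finite A] [Nonempty A] (hK : C.IsLinkComplex D K) {n : ℕ}
    (h : Set.univ ∉ cone n K) : C.IsLinkComplex D (cone n K) where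
  down := fun X ⟨u, hu⟩ Y hY => ⟨u, fun Z hZ => hu Z (hZ.trans hY)⟩
  preserves := by
    intro ι _ f hf W hW
    choose u hu using hW
    refine ⟨f u, fun Y hY hYn => ?_⟩
    have hY' : ∀ y ∈ Y, ∃ w ∈ W, f w = y := fun y hy => hY hy
    choose! s hs hsf using hY'
    have h1 : insert (f u) Y = f '' (insert u (s '' Y)) := by
      rw [Set.image_insert_eq, Set.image_image]
      congr 1
      ext y
      constructor
      · exact fun hy => ⟨y, hy, hsf y hy⟩
      · rintro ⟨z, hz, rfl⟩
        simpa only [hsf z hz] using hz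
    rw [h1]
    refine hK.preserves hf _ fun i => ?_
    rw [Set.image_insert_eq, Set.image_image]
    refine hu i _ ?_ ((Set.ncard_image_le (Set.toFinite _)).trans_lt hYn)
    rintro _ ⟨y, hy, rfl⟩
    exact ⟨s y, hs y hy, rfl⟩
  singleton := fun a => hK.subset_cone n (hK.singleton a)
  link := fun x y h => hK.subset_cone n (hK.link x y h)
  proper := h

/-- If all faces of a complex can be coned off simultaneously, then it yields a proper symmetric
relation with a nonempty center. -/
theorem of_univ_mem_cone [Finite A] (hC : C.IsCore) (hK : C.IsLinkComplex D K) {n : ℕ}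
    (hn : 2 ≤ n) {X : Set A} (hX : X ∉ K) (hXn : X.ncard = n) (h : Set.univ ∈ cone n K) :
    C.IsDictatorial ∨ ∃ Y : Set A, C.Closed Y ∧ Y.Nonempty ∧ Y ≠ Set.univ ∧
      C.Absorbs Y Set.univ := by
  -- Two vertices are related if they form a face with any `n - 2` or fewer further ones. The apex
  -- is central, and two vertices of `X` are unrelated.
  refine isDictatorial_or_exists_absorbs hC
    (E := fun x y => ∀ Y : Set A, Y.ncard + 2 ≤ n → insert x (insert y Y) ∈ K) ?_ ?_ ?_ ?_
  · intro ι _ f hf x y hxy Y hY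
    obtain ⟨g, g', hg, hg', h1, h2, h3, h4⟩ := exists_idempotent hC hf
    have h5 : insert (f x) (insert (f y) Y) =
        f '' (insert x (insert y ((fun a (_ : ι) => g' a) '' Y))) := by
      rw [Set.image_insert_eq, Set.image_insert_eq, Set.image_image]
      simp only [h3, h2, Set.image_id']
    rw [h5]
    refine hK.preserves hf _ fun i => ?_
    rw [Set.image_insert_eq, Set.image_insert_eq, Set.image_image]
    exact hxy i _ ((Nat.add_le_add_right (Set.ncard_image_le (Set.toFinite _)) 2).trans hY)
  · intro a b hab Y hY
    rw [Set.insert_comm]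
    exact hab Y hY
  · obtain ⟨u, hu⟩ := h
    refine ⟨u, fun y Y hY => hu _ (Set.subset_univ _) ?_⟩
    have := Set.ncard_insert_le y Y
    omega
  · obtain ⟨a, b, ha, hb, hab⟩ := (Set.one_lt_ncard_iff (Set.toFinite X)).1 (by omega)
    refine ⟨a, b, fun hE => hX ?_⟩
    have hb' : b ∈ X \ {a} := ⟨hb, hab.symm⟩
    have h1 := Set.ncard_sdiff_singleton_add_one ha (Set.toFinite _)
    have h2 := Set.ncard_sdiff_singleton_add_one hb' (Set.toFinite _)
    have h3 := hE ((X \ {a}) \ {b}) (by omega)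
    rwa [Set.insert_sdiff_singleton, Set.insert_eq_of_mem hb', Set.insert_sdiff_singleton,
      Set.insert_eq_of_mem ha] at h3

/-- The faces of a maximal complex, listed as tuples, form an exchange relation. -/
theorem isExchangeRelation [Finite A] (hK : C.IsLinkComplex D K) {n : ℕ} (hn : 3 ≤ n)
    (hsmall : ∀ X : Set A, X.ncard < n → X ∈ K) (hcone : cone n K ⊆ K) :
    C.IsExchangeRelation {x : Fin n → A | Set.range x ∈ K} := by
  have hinj : ∀ x : Fin n → A, ¬ Function.Injective x → Set.range x ∈ K := by
    intro x hx
    apply hsmall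
    rw [← Set.image_univ]
    refine lt_of_le_of_ne ((Set.ncard_image_le (Set.toFinite _)).trans (by simp)) fun h => hx ?_
    rw [← Set.injOn_univ]
    exact Set.injOn_of_ncard_image_eq (by simpa using h)
  refine ⟨hn, ?_, hinj, ?_⟩
  · intro ι _ f hf X hX
    have h1 : Set.range (rowwise f X) = f '' (Set.range fun r i => X i r) := by
      rw [← Set.range_comp]; rfl
    rw [Set.mem_ofPred_eq, h1]
    refine hK.preserves hf _ fun i => ?_
    rw [← Set.range_comp]
    exact hX i
  · rintro x ⟨u, hu⟩
    by_cases hx : Function.Injective x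
    -- A set `Y` with fewer than `n` elements misses some `x r`, so `insert u Y` survives replacing
    -- `x r` by `u`.
    · refine hcone ⟨u, fun Y hY hYn => ?_⟩
      obtain ⟨r, hr⟩ : ∃ r, x r ∉ Y := by
        by_contra! h
        have h1 : Set.range x ⊆ Y := by rintro _ ⟨r, rfl⟩; exact h r
        have h2 := Set.ncard_le_ncard h1 (Set.toFinite _)
        rw [← Set.image_univ, Set.ncard_image_of_injective _ hx] at h2
        simp at h2
        omega
      refine hK.down _ (hu r) _ ?_
      rintro y (rfl | hy)
      · exact ⟨r, by simp⟩
      · obtain ⟨s, rfl⟩ := hY hy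
        exact ⟨s, Function.update_of_ne (by rintro rfl; exact hr hy) _ _⟩
    · exact hinj x hx

end IsLinkComplex

theorem isDictatorial_or_exists_absorbs_of_digraph [Finite A] [Nonempty A] (hC : C.IsCore)
    (hD : C.PreservesRel D.Adj) (hs : D.IsSmooth) (hl : D.IsLoopless) (hlink : D.IsLinked) :
    C.IsDictatorial ∨ ∃ Y : Set A, C.Closed Y ∧ Y.Nonempty ∧ Y ≠ Set.univ ∧
      C.Absorbs Y Set.univ := by
  classical
  obtain ⟨K, hK, hmax⟩ := (Set.toFinite {K | C.IsLinkComplex D K}).exists_maximal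
    ⟨_, isLinkComplex_of_digraph hD hs hl⟩
  have hex : ∃ n, ∃ X : Set A, X ∉ K ∧ X.ncard = n := ⟨_, _, hK.proper, rfl⟩
  obtain ⟨X, hX, hXn⟩ := Nat.find_spec hex
  have hmin : ∀ Y : Set A, Y.ncard < Nat.find hex → Y ∈ K := by
    intro Y hY
    by_contra h
    exact Nat.find_min hex hY ⟨Y, h, rfl⟩
  generalize Nat.find hex = n at hXn hmin
  have hn : 2 ≤ n := by
    by_contra! h
    apply hX
    obtain ⟨a⟩ := ‹Nonempty A›
    obtain h0 | h1 : n = 0 ∨ n = 1 := by omega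
    · rw [h0, Set.ncard_eq_zero (Set.toFinite _)] at hXn
      exact hK.down _ (hK.singleton a) _ (by simp [hXn])
    · rw [h1, Set.ncard_eq_one] at hXn
      obtain ⟨b, rfl⟩ := hXn
      exact hK.singleton b
  by_cases hcone : Set.univ ∈ cone n K
  · exact IsLinkComplex.of_univ_mem_cone hC hK hn hX hXn hcone
  have hle : cone n K ⊆ K := hmax (hK.cone_isLinkComplex hcone) (hK.subset_cone n)
  have hn3 : 3 ≤ n := by
    by_contra! h
    obtain rfl : n = 2 := by omega
    -- For `n = 2`, closure under coning makes the edges of `K` transitive, with the middle vertex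
    -- as apex; linkedness then puts every pair into `K`.
    have key : ∀ a b, Relation.TransGen D.Link a b → {a, b} ∈ K := by
      intro a b hab
      induction hab with
      | single h => exact hK.link _ _ h
      | @tail c b _ h ih =>
        refine hle ⟨c, fun Y hY hYn => ?_⟩
        obtain h0 | h1 : Y.ncard = 0 ∨ Y.ncard = 1 := by omega
        · rw [Set.ncard_eq_zero (Set.toFinite _)] at h0
          simpa [h0] using hK.singleton c
        · obtain ⟨y, rfl⟩ := Set.ncard_eq_one.1 h1
          rcases hY rfl with rfl | h2
          · rwa [Set.pair_comm]
          · obtain rfl : y = b := h2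
            exact hK.link _ _ h
    obtain ⟨a, b, -, rfl⟩ := Set.ncard_eq_two.1 hXn
    exact hX (key a b (hlink a b))
  left
  refine (hK.isExchangeRelation hn3 hmin hle).isDictatorial hC fun h => hX ?_
  have e : Fin n ≃ X := (Finite.equivFinOfCardEq hXn).symm
  have h1 : (fun r => (e r : A)) ∈ {x : Fin n → A | Set.range x ∈ K} := h ▸ trivial
  have h2 : Set.range (fun r => (e r : A)) = X := by
    ext a
    constructor
    · rintro ⟨r, rfl⟩
      exact (e r).2
    · exact fun ha => ⟨e.symm ⟨a, ha⟩, by simp⟩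
  rwa [Set.mem_ofPred_eq, h2] at h1

end OpClone

/-! ### Reduction to absorbing subdigraphs -/

namespace Digraph

variable {A : Type u} (D : Digraph A)

/-- The digraph with all edges reversed. -/
def reverse : Digraph A := ⟨fun a b => D.Adj b a⟩

/-- The induced subdigraph on a set of vertices. -/
def restrict (B : Set A) : Digraph B := ⟨fun a b => D.Adj a b⟩

variable {D}

theorem IsSmooth.reverse (h : D.IsSmooth) : D.reverse.IsSmooth := ⟨h.2, h.1⟩

/-- Along a link path, successive common out-neighbours share an in-neighbour, so they form a link
path of the reverse. -/
theorem IsLinked.reverse (hl : D.IsLinked) (hs : D.IsSmooth) : D.reverse.IsLinked := by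
  have key : ∀ a b, Relation.TransGen D.Link a b → ∀ x y, D.Adj a x → D.Adj b y →
      Relation.TransGen D.reverse.Link x y := by
    intro a b hab
    induction hab with
    | single h =>
      intro x y hx hy
      obtain ⟨z, h1, h2⟩ := h
      exact (Relation.TransGen.single ⟨_, hx, h1⟩).tail ⟨_, h2, hy⟩
    | tail _ h ih =>
      intro x y hx hy
      obtain ⟨z, h1, h2⟩ := h
      exact (ih x z hx h1).tail ⟨_, h2, hy⟩
  intro x y
  obtain ⟨a, ha⟩ := hs.2 x
  obtain ⟨b, hb⟩ := hs.2 y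
  exact key a b (hl a b) x y ha hb

end Digraph

namespace OpClone

variable {A : Type u} {C : OpClone A} {D : Digraph A}

/-- The clone induced on a set. -/
def restrict (C : OpClone A) (B : Set A) : OpClone B where
  mem := fun {ι} f => ∃ f₀ : (ι → A) → A, C.mem f₀ ∧ ∀ x, (f x : A) = f₀ fun i => x i
  proj := fun i => ⟨_, C.proj i, fun _ => rfl⟩
  comp := by
    rintro ι κ f g ⟨f₀, hf₀, hf⟩ hg
    choose g₀ hg₀ hg using hg
    exact ⟨_, C.comp hf₀ hg₀, fun x => by simp only [hf, hg]⟩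

theorem IsCore.restrict (hC : C.IsCore) (B : Set A) : (C.restrict B).IsCore := by
  rintro g ⟨f₀, hf₀, hf⟩ a b hab
  have h1 := hC _ (unary_diag hf₀)
  apply Subtype.ext
  apply h1
  have h2 := hf fun _ => a
  have h3 := hf fun _ => b
  exact h2.symm.trans ((congrArg Subtype.val hab).trans h3)

theorem PreservesRel.restrict (hD : C.PreservesRel D.Adj) (B : Set A) :
    (C.restrict B).PreservesRel (D.restrict B).Adj := by
  rintro ι _ f ⟨f₀, hf₀, hf⟩ x y hxy
  have := hD hf₀ (fun i => (x i : A)) (fun i => (y i : A)) hxy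
  rw [← hf, ← hf] at this
  exact this

theorem IsDictatorial.of_restrict {B : Set A} (hB : C.Closed B)
    (h : (C.restrict B).IsDictatorial) : C.IsDictatorial := by
  obtain ⟨d, U, S, hSU, ⟨s, hs⟩, ⟨u, hu, hu'⟩, h⟩ := h
  let e : (Fin d → B) → Fin d → A := fun y r => y r
  have he : Function.Injective e := fun y z hyz => by
    ext r
    exact congrFun hyz r
  refine ⟨d, e '' U, e '' S, Set.image_mono hSU, ⟨_, s, hs, rfl⟩,
    ⟨e u, ⟨u, hu, rfl⟩, fun ⟨v, hv, hvu⟩ => hu' (he hvu ▸ hv)⟩, fun ι _ f hf => ?_⟩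
  let fB : (ι → B) → B := fun x => ⟨f fun i => x i, hB hf _ fun i => (x i).2⟩
  obtain ⟨j, hj⟩ := h ι fB ⟨f, hf, fun _ => rfl⟩
  refine ⟨j, fun X hX => ?_⟩
  choose X' hX' hXX' using hX
  obtain ⟨h1, h2⟩ := hj X' hX'
  have h3 : rowwise f X = e (rowwise fB X') := by
    obtain rfl : X = fun i => e (X' i) := by ext i; rw [hXX']
    rfl
  rw [h3, he.mem_set_image, he.mem_set_image, ← hXX', he.mem_set_image]
  exact ⟨h1, h2⟩

theorem Closed.successors {B : Set A} (hB : C.Closed B) (hD : C.PreservesRel D.Adj) :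
    C.Closed {y | ∃ x ∈ B, D.Adj x y} := by
  intro ι _ f hf y hy
  choose x hx hxy using hy
  exact ⟨f x, hB hf x hx, hD hf x y hxy⟩

theorem AbsorbsVia.successors {B : Set A} {ι : Type} [Finite ι] {t : (ι → A) → A}
    (h : AbsorbsVia t B Set.univ) (ht : C.mem t) (hD : C.PreservesRel D.Adj) (hs : D.IsSmooth) :
    AbsorbsVia t {y | ∃ x ∈ B, D.Adj x y} Set.univ := by
  intro i y _ hy
  have h1 : ∀ k, ∃ x, D.Adj x (y k) ∧ (k ≠ i → x ∈ B) := by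
    intro k
    by_cases hk : k = i
    · obtain ⟨x, hx⟩ := hs.2 (y k)
      exact ⟨x, hx, fun h => absurd hk h⟩
    · obtain ⟨x, hx, hxy⟩ := hy k hk
      exact ⟨x, hxy, fun _ => hx⟩
  choose x hx hxB using h1
  exact ⟨t x, h i x trivial hxB, hD ht x y hx⟩

theorem PreservesRel.reverse (hD : C.PreservesRel D.Adj) : C.PreservesRel D.reverse.Adj :=
  fun _ _ _ hf x y hxy => hD hf y x hxy

/-- The smooth part of an absorbing subuniverse that meets all in-neighborhoods. -/
theorem exists_smooth_absorbing [Finite A] (hD : C.PreservesRel D.Adj) (hs : D.IsSmooth)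
    {ι : Type} [Finite ι] {t : (ι → A) → A} (ht : C.mem t) {B : Set A} (hB : C.Closed B)
    (hne : B.Nonempty) (habs : AbsorbsVia t B Set.univ) (hpred : ∀ a, ∃ b ∈ B, D.Adj b a) :
    ∃ X ⊆ B, C.Closed X ∧ X.Nonempty ∧ AbsorbsVia t X Set.univ ∧ (D.restrict X).IsSmooth := by
  let T : Set (Set A) := {X | X ⊆ B ∧ C.Closed X ∧ X.Nonempty ∧ AbsorbsVia t X Set.univ ∧
    ∀ a ∈ X, ∃ b ∈ X, D.Adj b a}
  obtain ⟨X, ⟨h1, h2, h3, h4, h5⟩, hmin⟩ := (Set.toFinite T).exists_minimal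
    ⟨B, subset_rfl, hB, hne, habs, fun a _ => hpred a⟩
  -- Discarding vertices without successor in `X` keeps the predecessor condition, since a
  -- predecessor has a successor by definition. Minimality shows that nothing is discarded.
  have hX : {x | x ∈ X ∧ ∃ y ∈ X, D.Adj x y} ∈ T := by
    refine ⟨fun x hx => h1 hx.1, ?_, ?_, ?_, ?_⟩
    · intro κ _ f hf x hx
      exact ⟨h2 hf x fun i => (hx i).1,
        h2.successors (D := D.reverse) hD.reverse hf x fun i => (hx i).2⟩
    · obtain ⟨x, hx⟩ := h3
      obtain ⟨y, hy, hyx⟩ := h5 x hx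
      exact ⟨y, hy, x, hx, hyx⟩
    · intro i x _ hx
      exact ⟨h4 i x trivial fun k hk => (hx k hk).1,
        h4.successors (D := D.reverse) ht hD.reverse hs.reverse i x trivial
          fun k hk => (hx k hk).2⟩
    · rintro a ⟨ha, -⟩
      obtain ⟨b, hb, hba⟩ := h5 a ha
      exact ⟨b, ⟨hb, a, ha, hba⟩, hba⟩
  have hle := hmin hX fun x hx => hx.1
  refine ⟨X, h1, h2, h3, h4, fun a => ?_, fun a => ?_⟩
  · obtain ⟨-, y, hy, h⟩ := hle a.2
    exact ⟨⟨y, hy⟩, h⟩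
  · obtain ⟨y, hy, h⟩ := h5 a a.2
    exact ⟨⟨y, hy⟩, h⟩

/-- A smooth subdigraph on an absorbing subuniverse of a linked digraph is linked. -/
theorem isLinked_restrict (hD : C.PreservesRel D.Adj)
    (hl : D.IsLinked) {ι : Type} [Finite ι] {t : (ι → A) → A} (ht : C.mem t)
    (hid : ∀ a, t (fun _ => a) = a) {X : Set A}
    (habs : AbsorbsVia t X Set.univ) (hsX : (D.restrict X).IsSmooth) :
    (D.restrict X).IsLinked := by
  classical
  cases nonempty_fintype ι
  intro b b'
  have hmem : ∀ (v : ι → X) i c, t (Function.update (fun k => (v k : A)) i c) ∈ X := by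
    intro v i c
    refine habs i _ trivial fun k hk => ?_
    rw [Function.update_of_ne hk]
    exact (v k).2
  -- A link outside `X` in one argument becomes a link inside `X`: the common out-neighbour is `t`
  -- of successors in `X` and of `z`, absorbed into `X`.
  have step : ∀ (v : ι → X) i c c', D.Link c c' →
      (D.restrict X).Link ⟨_, hmem v i c⟩ ⟨_, hmem v i c'⟩ := by
    rintro v i c c' ⟨z, h1, h2⟩
    choose w hw using fun k => hsX.1 (v k)
    refine ⟨⟨_, hmem w i z⟩, hD ht _ _ fun k => ?_, hD ht _ _ fun k => ?_⟩
    all_goals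
      by_cases hk : k = i
      · subst hk; simpa
      · rw [Function.update_of_ne hk, Function.update_of_ne hk]; exact hw k
  have walk : ∀ (v : ι → X) i c c', Relation.TransGen D.Link c c' →
      Relation.ReflTransGen (D.restrict X).Link ⟨_, hmem v i c⟩ ⟨_, hmem v i c'⟩ := by
    intro v i c c' h
    induction h with
    | single h => exact Relation.ReflTransGen.single (step v i _ _ h)
    | tail _ h ih => exact ih.tail (step v i _ _ h)
  -- The arguments of `t` are switched from `b` to `b'` one at a time; idempotence identifies the
  -- two ends.
  have hS : ∀ S : Finset ι, ∀ y : X, (y : A) = t (fun i => if i ∈ S then b' else b) →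
      Relation.ReflTransGen (D.restrict X).Link b y := by
    intro S
    induction S using Finset.induction_on with
    | empty =>
      intro y hy
      obtain rfl : y = b := Subtype.ext (by simpa [hid] using hy)
      exact Relation.ReflTransGen.refl
    | insert a S ha ih =>
      intro y hy
      have h1 := walk (fun i => if i ∈ S then b' else b) a b b' (hl b b')
      have hy' : y = ⟨_, hmem (fun i => if i ∈ S then b' else b) a b'⟩ := by
        refine Subtype.ext (hy.trans (congrArg t ?_))
        ext i
        by_cases hi : i = a
        · subst hi; simp
        · by_cases hi' : i ∈ S <;> simp [hi, hi']
      rw [hy']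
      refine (ih _ (congrArg t ?_)).trans h1
      ext i
      by_cases hi : i = a
      · subst hi; simp [ha]
      · by_cases hi' : i ∈ S <;> simp [hi, hi']
  obtain ⟨z, hz⟩ := hsX.1 b
  refine Relation.TransGen.head' ⟨z, hz, hz⟩ (hS Finset.univ b' (by simp [hid]))

/-- A core clone that preserves a finite smooth linked loopless digraph acts by projections. -/
theorem isDictatorial_of_digraph {A : Type u} [Finite A] [Nonempty A] {C : OpClone A}
    (hC : C.IsCore) {D : Digraph A} (hD : C.PreservesRel D.Adj) (hs : D.IsSmooth)
    (hl : D.IsLinked) (hloop : D.IsLoopless) : C.IsDictatorial := by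
  obtain ⟨k, hk⟩ : ∃ k, Nat.card A = k := ⟨_, rfl⟩
  induction k using Nat.strong_induction_on generalizing A with
  | _ k ih =>
    rcases isDictatorial_or_exists_absorbs_of_digraph hC hD hs hloop hl with
      h | ⟨Y, hY, hYne, hYu, ι, _, t, ht, hid, habs⟩
    · exact h
    let T : Set (Set A) := {B | C.Closed B ∧ B.Nonempty ∧ AbsorbsVia t B Set.univ ∧ B ≠ Set.univ}
    obtain ⟨B, ⟨h1, h2, h3, h4⟩, hmax⟩ := (Set.toFinite T).exists_maximal
      ⟨Y, hY, hYne, habs, hYu⟩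
    have reduce : ∀ (D : Digraph A), C.PreservesRel D.Adj → D.IsSmooth → D.IsLinked →
        D.IsLoopless → ∀ B ∈ T, (∀ a, ∃ b ∈ B, D.Adj b a) → C.IsDictatorial := by
      rintro D hD hs hl hloop B ⟨h1, h2, h3, h4⟩ hpred
      obtain ⟨X, hXB, hX, ⟨x, hx⟩, hXabs, hXs⟩ :=
        exists_smooth_absorbing hD hs ht h1 h2 h3 hpred
      have : Nonempty X := ⟨⟨x, hx⟩⟩
      refine IsDictatorial.of_restrict hX (ih (Nat.card X) ?_ (hC.restrict X) (hD.restrict X) hXs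
        (isLinked_restrict hD hl ht hid hXabs hXs) (fun a => hloop a) rfl)
      rw [← hk, Nat.card_coe_set_eq, ← Set.ncard_univ]
      refine Set.ncard_lt_ncard (Set.ssubset_univ_iff.2 fun h => h4 ?_)
      exact Set.eq_univ_of_univ_subset (h ▸ hXB)
    let B₁ : Set A := {y | ∃ x ∈ B, D.Adj x y}
    by_cases hB₁ : B₁ = Set.univ
    · exact reduce D hD hs hl hloop B ⟨h1, h2, h3, h4⟩ fun a =>
        (hB₁ ▸ trivial : a ∈ B₁)
    have hB₁T : B₁ ∈ T := by
      refine ⟨h1.successors hD, ?_, h3.successors ht hD hs, hB₁⟩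
      obtain ⟨b, hb⟩ := h2
      obtain ⟨c, hc⟩ := hs.1 b
      exact ⟨c, b, hb, hc⟩
    let B₂ : Set A := {y | ∃ x ∈ B₁, D.reverse.Adj x y}
    have hBB₂ : B ⊆ B₂ := by
      intro b hb
      obtain ⟨c, hc⟩ := hs.1 b
      exact ⟨c, ⟨b, hb, hc⟩, hc⟩
    by_cases hB₂ : B₂ = Set.univ
    · exact reduce D.reverse hD.reverse hs.reverse (hl.reverse hs) (fun a => hloop a) B₁ hB₁T
        fun a => (hB₂ ▸ trivial : a ∈ B₂)
    exfalso
    -- Going forward and back from `B` now yields a proper set, so by maximality `B` is closed under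
    -- links, and linkedness makes it everything.
    have hle := hmax ⟨hB₁T.1.successors hD.reverse, h2.mono hBB₂,
      hB₁T.2.2.1.successors ht hD.reverse hs.reverse, hB₂⟩ hBB₂
    apply h4
    obtain ⟨b, hb⟩ := h2
    refine Set.eq_univ_of_forall fun a => ?_
    induction hl b a with
    | single h =>
      obtain ⟨z, hz, hz'⟩ := h
      exact hle ⟨z, ⟨_, hb, hz⟩, hz'⟩
    | tail _ h ih =>
      obtain ⟨z, hz, hz'⟩ := h
      exact hle ⟨z, ⟨_, ih, hz⟩, hz'⟩

end OpClone

/-! ### From polymorphisms to pp-interpretations -/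

namespace PrimitivePositive

open FirstOrder FirstOrder.Language

variable {L : FirstOrder.Language.{v, w}} {M : Type u} [L.Structure M]

/-- The clone of polymorphisms of (the relations of) a structure. -/
def polymorphisms (L : FirstOrder.Language.{v, w}) (M : Type u) [L.Structure M] : OpClone M where
  mem := fun {ι} f => ∀ ⦃n : ℕ⦄ (R : L.Relations n) (X : ι → Fin n → M),
    (∀ i, Structure.RelMap R (X i)) → Structure.RelMap R (OpClone.rowwise f X)
  proj := fun j _ _ _ hX => hX j
  comp := fun hf hg _ R X hX =>
    hf R (fun _ => OpClone.rowwise _ X) fun i => hg i R X hX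

theorem IsPP.exs {α : Type*} : ∀ {m : ℕ} {φ : L.BoundedFormula α m}, IsPP φ → IsPP φ.exs
  | 0, _, h => h
  | _ + 1, φ, h => (IsPP.exs h.ex : IsPP φ.ex.exs)

theorem exists_isPP_conj {α : Type*} {m : ℕ} (t : L.Term (α ⊕ Fin m)) {κ : Type*} [Finite κ]
    (φ : κ → L.BoundedFormula α m) (h : ∀ k, IsPP (φ k)) :
    ∃ ψ : L.BoundedFormula α m, IsPP ψ ∧
      ∀ (v : α → M) (xs : Fin m → M), ψ.Realize v xs ↔ ∀ k, (φ k).Realize v xs := by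
  have key : ∀ l : List κ, ∃ ψ : L.BoundedFormula α m, IsPP ψ ∧
      ∀ (v : α → M) (xs : Fin m → M), ψ.Realize v xs ↔ ∀ k ∈ l, (φ k).Realize v xs := by
    intro l
    induction l with
    | nil => exact ⟨t.bdEqual t, .atomic (.equal t t), fun v xs => by simp⟩
    | cons k l ih =>
      obtain ⟨ψ, h1, h2⟩ := ih
      exact ⟨φ k ⊓ ψ, (h k).inf h1, fun v xs => by simp [h2]⟩
  cases nonempty_fintype κ
  obtain ⟨ψ, h1, h2⟩ := key (Finset.univ : Finset κ).toList
  exact ⟨ψ, h1, fun v xs => by simp [h2]⟩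

/-- On a finite structure, the relations invariant under all polymorphisms are pp-definable. -/
theorem ppDefinable_of_preserves [Finite M] [Nonempty M] {α : Type} [Finite α]
    {S : Set (α → M)} (hS : (polymorphisms L M).Preserves S) : PPDefinable L S := by
  classical
  obtain ⟨k, ⟨e₀⟩⟩ := Finite.exists_equiv_fin S
  let X : Fin k → α → M := fun i => e₀.symm i
  obtain ⟨m, ⟨e⟩⟩ := Finite.exists_equiv_fin (Fin k → M)
  obtain ⟨a⟩ := ‹Nonempty M›
  let t : (Fin k → M) → L.Term (α ⊕ Fin m) := fun z => Term.var (Sum.inr (e z))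
  have ht : ∀ z v (xs : Fin m → M), (t z).realize (Sum.elim v xs) = xs (e z) := fun _ _ _ => rfl
  -- The quantified variables are the value table of an operation. One violated constraint per table
  -- that is not a polymorphism suffices to say "polymorphism", so infinitely many relation symbols
  -- do no harm.
  have hφ : ∀ g : Fin m → M, ∃ φ : L.BoundedFormula α m, IsPP φ ∧
      (∀ v, φ.Realize v g → (polymorphisms L M).mem fun z => g (e z)) ∧
      ∀ v (xs : Fin m → M), ((polymorphisms L M).mem fun z => xs (e z)) → φ.Realize v xs := by
    intro g
    by_cases hg : (polymorphisms L M).mem fun z => g (e z)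
    · exact ⟨(t fun _ => a).bdEqual (t fun _ => a), .atomic (.equal _ _), fun _ _ => hg,
        fun _ _ _ => by simp⟩
    · have hg' := hg
      simp only [polymorphisms, not_forall] at hg'
      obtain ⟨n, R, Y, hY, hgY⟩ := hg'
      refine ⟨R.boundedFormula fun r => t fun i => Y i r, .atomic (.rel _ _), fun v h => ?_,
        fun v xs hxs => ?_⟩
      · exact absurd h hgY
      · exact hxs R Y hY
  choose φ hφ1 hφ2 hφ3 using hφ
  obtain ⟨ψ₁, h1, h1'⟩ := exists_isPP_conj (M := M) (t fun _ => a) φ hφ1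
  obtain ⟨ψ₂, h2, h2'⟩ := exists_isPP_conj (M := M) (t fun _ => a)
    (fun b : α => (Term.var (Sum.inl b) : L.Term (α ⊕ Fin m)).bdEqual (t fun i => X i b))
    fun b => .atomic (.equal _ _)
  refine ⟨(ψ₁ ⊓ ψ₂).exs, (h1.inf h2).exs, fun v => ?_⟩
  rw [BoundedFormula.realize_exs]
  simp only [BoundedFormula.realize_inf, h1', h2', BoundedFormula.realize_bdEqual,
    Term.realize_var, Sum.elim_inl, ht]
  constructor
  · intro hv
    -- A tuple of `S` is witnessed by the projection to its own index.
    refine ⟨fun r => e.symm r (e₀ ⟨v, hv⟩), fun g => hφ3 g v _ ?_, fun b => ?_⟩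
    · simpa using (polymorphisms L M).proj (e₀ ⟨v, hv⟩)
    · simp [X]
  · rintro ⟨xs, h3, h4⟩
    have h5 := hφ2 xs v (h3 xs)
    have h6 := hS h5 X fun i => (e₀.symm i).2
    convert h6 using 1
    ext b
    exact h4 b

/-- If the polymorphisms of a finite structure act by projections, then the structure
pp-interprets all finite structures. -/
theorem ppInterprets_of_isDictatorial [Finite M] [Nonempty M]
    (h : (polymorphisms L M).IsDictatorial) (L' : FirstOrder.Language) [L'.IsRelational] (N : Type*)
    [L'.Structure N] [Finite N] : PPInterprets L M L' N := by
  classical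
  obtain ⟨d, U, S, hSU, ⟨s, hs⟩, ⟨s', hs', hs''⟩, h⟩ := h
  -- The extra element keeps the number of blocks positive even if `N` is empty.
  obtain ⟨q, ⟨e⟩⟩ := Finite.exists_equiv_fin (Option N)
  let e' : N → Fin q := fun b => e (some b)
  have he' : Function.Injective e' := fun b c hbc => by simpa [e'] using hbc
  have hq : 0 < q := Fin.pos (e none)
  have hd : 0 < d := by
    rcases Nat.eq_zero_or_pos d with rfl | h
    · exact absurd (Subsingleton.elim s s' ▸ hs) hs''
    · exact h
  -- One-hot coding: `q` blocks from `U`, of which exactly the one with index `e' b` lies in `S`. A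
  -- polymorphism selects the whole code of one argument.
  let P : (Fin (q * d) → M) → N → Prop := fun a b => ∀ l : Fin q,
    (fun r => a (finProdFinEquiv (l, r))) ∈ U ∧
      ((fun r => a (finProdFinEquiv (l, r))) ∈ S ↔ l = e' b)
  have hP : ∀ a b c, P a b → P a c → b = c := by
    intro a b c hb hc
    exact he' (((hc (e' b)).2.1 ((hb (e' b)).2.2 rfl)))
  let f : (Fin (q * d) → M) →. N := fun a => ⟨∃ b, P a b, fun h => h.choose⟩
  have hf : ∀ a b, b ∈ f a ↔ P a b := by
    intro a b
    constructor
    · rintro ⟨h, rfl⟩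
      exact h.choose_spec
    · intro hb
      exact ⟨⟨b, hb⟩, hP a _ _ (Exists.choose_spec (⟨b, hb⟩ : ∃ b, P a b)) hb⟩
  have hdef : ∀ {n : ℕ} (R : (Fin n → N) → Prop), PPDefinable L (preimageRel f R) := by
    intro n R
    refine ppDefinable_of_preserves fun ι _ p hp X hX => ?_
    obtain ⟨j, hj⟩ := h ι p hp
    choose y hy hyR using hX
    refine ⟨y j, fun i => ?_, hyR j⟩
    refine (hf (fun c => OpClone.rowwise p X (i, c)) (y j i)).2 fun l => ?_
    have h1 : ∀ k, P (fun c => X k (i, c)) (y k i) := fun k =>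
      (hf (fun c => X k (i, c)) (y k i)).1 (hy k i)
    obtain ⟨h2, h3⟩ := hj (fun k r => X k (i, finProdFinEquiv (l, r))) fun k => (h1 k l).1
    exact ⟨h2, h3.trans (h1 j l).2⟩
  refine ⟨q * d, Nat.mul_pos hq hd, f, fun b => ?_, hdef _, hdef _, fun n R => hdef _⟩
  let a : Fin (q * d) → M := fun c =>
    if (finProdFinEquiv.symm c).1 = e' b then s (finProdFinEquiv.symm c).2 else
      s' (finProdFinEquiv.symm c).2
  refine ⟨a, (hf a b).2 fun l => ?_⟩
  simp only [a, Equiv.symm_apply_apply]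
  by_cases hl : l = e' b
  · simpa [hl] using ⟨hSU hs, hs⟩
  · simpa [hl] using ⟨hs', hs''⟩

theorem preservesRel_polymorphisms {A : Type u} (D : Digraph A) (G : Subgroup D.Aut) :
    (polymorphisms (orbitLanguage D G) A).PreservesRel D.Adj := by
  intro ι _ f hf x y hxy
  exact hf (OrbitSymbol.adj : (orbitLanguage D G).Relations 2) (fun i => ![x i, y i]) hxy

/-- A unary polymorphism preserves the orbit of a tuple enumerating `A`, so it agrees everywhere
with an element of `G`. -/
theorem isCore_polymorphisms {A : Type u} [Finite A] [Nonempty A] (D : Digraph A)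
    (G : Subgroup D.Aut) : (polymorphisms (orbitLanguage D G) A).IsCore := by
  intro g hg
  obtain ⟨n, hn⟩ : ∃ n, Nat.card A = n + 1 :=
    ⟨Nat.card A - 1, by have := Nat.card_pos (α := A); omega⟩
  let e : Fin (n + 1) → A := (Finite.equivFinOfCardEq hn).symm
  have he : Function.Bijective e := (Finite.equivFinOfCardEq hn).symm.bijective
  let O : MulAction.orbitRel.Quotient G (Fin (n + 1) → A) := Quotient.mk'' e
  have h1 := hg (OrbitSymbol.orbit O : (orbitLanguage D G).Relations (n + 1)) (fun _ => e)
    fun _ => MulAction.orbitRel.Quotient.mem_orbit.2 rfl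
  have h2 : (fun r => g (e r)) ∈ MulAction.orbit G e := h1
  obtain ⟨σ, hσ⟩ := h2
  intro a b hab
  obtain ⟨i, rfl⟩ := he.2 a
  obtain ⟨j, rfl⟩ := he.2 b
  have h3 : σ • e i = σ • e j := (congrFun hσ i).trans (hab.trans (congrFun hσ j).symm)
  exact MulAction.injective σ h3

end PrimitivePositive

theorem theorem1 {A : Type u} [Finite A] [Nonempty A] (D : Digraph A)
    (hsmooth : D.IsSmooth) (hlinked : D.IsLinked) (hloopless : D.IsLoopless)
    (G : Subgroup D.Aut) :
    PrimitivePositive.PPInterprets (PrimitivePositive.orbitLanguage D G) A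
      FirstOrder.Language.graph PrimitivePositive.K3 ∧
    ∀ (L : FirstOrder.Language.{v, w}) [L.IsRelational] (B : Type x) [L.Structure B] [Finite B],
      PrimitivePositive.PPInterprets (PrimitivePositive.orbitLanguage D G) A L B := by
  have h : (PrimitivePositive.polymorphisms (PrimitivePositive.orbitLanguage D G) A).IsDictatorial :=
    OpClone.isDictatorial_of_digraph (PrimitivePositive.isCore_polymorphisms D G)
      (PrimitivePositive.preservesRel_polymorphisms D G) hsmooth hlinked hloopless
  have : Finite PrimitivePositive.K3 := inferInstanceAs (Finite (Fin 3))
  exact ⟨PrimitivePositive.ppInterprets_of_isDictatorial h _ _,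
    fun L _ B _ _ => PrimitivePositive.ppInterprets_of_isDictatorial h L B⟩
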